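/- All groups are finite. For a group $G$ let $\pi(G)$ be the set of prime divisors of $|G|$. A class of groups is assumed to be closed under isomorphism. A formation is a class $\mathfrak F$ of groups that is closed under epimorphic images and such that $G\in\mathfrak F$ whenever $G$ has normal subgroups $N_1,\dots,N_n$ $(n\ge 1)$ with $G/N_i\in\mathfrak F$ for all $i$ and $\bigcap_{i=1}^n N_i=1$. It is hereditary if it is closed under subgroups. It is solubly saturated if $G/\Phi(G_{\mathfrak S})\in\mathfrak F$ implies $G\in\mathfrak F$, where $G_{\mathfrak S}$ is the soluble radical (largest soluble normal subgroup) of $G$ and $\Phi$ denotes the Frattini subgroup. A Schmidt group is a non-nilpotent group all of whose proper subgroups are nilpotent; a Schmidt $(p,q)$-group is a Schmidt group $S$ with $\pi(S)=\{p,q\}$ whose Sylow $p$-subgroup is normal. The Schmidt graph $\Gamma_{Sch}(G)$ is the directed graph with vertex set $\pi(G)$ in which $(p,q)$ is an edge if and only if $G$ has a subgroup that is a Schmidt $(p,q)$-group. Two such graphs are equal if they have the same vertex set and the same edge set. A class $\mathfrak F$ is recognized by $\Gamma_{Sch}$ if $G_1\in\mathfrak F$ and $\Gamma_{Sch}(G_1)=\Gamma_{Sch}(G_2)$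 imply $G_2\in\mathfrak F$. A group $G$ is $s$-critical for $\mathfrak F$ if $G\notin\mathfrak F$ but every proper subgroup of $G$ is in $\mathfrak F$. A formation $\mathfrak F$ has the Shemetkov property if every group that is $s$-critical for $\mathfrak F$ is a Schmidt group or has prime order. **Theorem.** Let $\mathfrak F$ be a nonempty formation. Then $\mathfrak F$ is recognized by $\Gamma_{Sch}$ if and only if $\mathfrak F$ is a hereditary solubly saturated formation with the Shemetkov property. -/

import Mathlib

universe u

/-- A class of finite groups: a property of finite groups, invariant under isomorphism. -/
structure FiniteGroupClass where
  /-- membership of a group in the class -/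
  Mem : (G : Type u) → [Group G] → Prop
  finite_of_mem : ∀ (G : Type u) [Group G], Mem G → Finite G
  mem_of_mulEquiv : ∀ (G H : Type u) [Group G] [Group H], (G ≃* H) → Mem G → Mem H

/-- A directed graph whose vertices are natural numbers, as a pair `(V, E)` of a vertex set and a
set of ordered pairs of vertices.  Equality of graphs is equality of both sets. -/
@[ext]
structure NatDigraph where
  verts : Set ℕ
  edges : Set (ℕ × ℕ)
  edges_subset : edges ⊆ verts ×ˢ verts

/-- A graph function assigns a graph to every finite group. -/
abbrev GraphFunction : Type (u + 1) :=
  (G : Type u) → [Group G] → [Finite G] → NatDigraph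

namespace FiniteGroupClass

/-- The class contains at least one group. -/
def IsNonempty (F : FiniteGroupClass.{u}) : Prop :=
  ∃ (G : Type u) (_ : Group G), F.Mem G

/-- Closure under epimorphic images. -/
def IsQClosed (F : FiniteGroupClass.{u}) : Prop :=
  ∀ (G H : Type u) [Group G] [Group H] (f : G →* H),
    Function.Surjective f → F.Mem G → F.Mem H

/-- Closure under (finite, nonempty) subdirect products. -/
def IsR₀Closed (F : FiniteGroupClass.{u}) : Prop :=
  ∀ (G : Type u) [Group G] [Finite G] (n : ℕ) (N : Fin n → Subgroup G) [∀ i, (N i).Normal],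
    1 ≤ n → (∀ i, F.Mem (G ⧸ N i)) → ⨅ i, N i = ⊥ → F.Mem G

/-- Closure under subgroups. -/
def IsSClosed (F : FiniteGroupClass.{u}) : Prop :=
  ∀ (G : Type u) [Group G] (H : Subgroup G), F.Mem G → F.Mem H

/-- A formation (possibly empty). -/
def IsFormation (F : FiniteGroupClass.{u}) : Prop :=
  F.IsQClosed ∧ F.IsR₀Closed

def IsHereditaryFormation (F : FiniteGroupClass.{u}) : Prop :=
  F.IsFormation ∧ F.IsSClosed

/-- `F` is recognized by `Γ`: a finite group with the same graph as some member is a member. -/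
def IsRecognizedBy (F : FiniteGroupClass.{u}) (Γ : GraphFunction.{u}) : Prop :=
  ∀ (G₁ G₂ : Type u) [Group G₁] [Group G₂] [Finite G₁] [Finite G₂],
    F.Mem G₁ → Γ G₁ = Γ G₂ → F.Mem G₂

end FiniteGroupClass

/-- The set `π(G)` of prime divisors of the order of `G`. -/
def groupPrimes (G : Type u) [Group G] : Set ℕ :=
  ↑(Nat.card G).primeFactors

/-- A Schmidt group: a finite non-nilpotent group all of whose proper subgroups are nilpotent. -/
def IsSchmidtGroup (G : Type u) [Group G] : Prop :=
  Finite G ∧ ¬ Group.IsNilpotent G ∧ ∀ H : Subgroup G, H ≠ ⊤ → Group.IsNilpotent H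

/-- A Schmidt `(p, q)`-group: a Schmidt group with `π(G) = {p, q}` and normal Sylow
`p`-subgroup. -/
def IsSchmidtPQGroup (p q : ℕ) (G : Type u) [Group G] : Prop :=
  IsSchmidtGroup G ∧ groupPrimes G = {p, q} ∧ ∃ P : Sylow p G, (P : Subgroup G).Normal

/-- The prime divisors of the order of a subgroup divide the order of the group. -/
theorem groupPrimes_subgroup_subset {G : Type u} [Group G] [Finite G] (H : Subgroup G) :
    groupPrimes H ⊆ groupPrimes G :=
  Finset.coe_subset.2 (Nat.primeFactors_mono H.card_subgroup_dvd_card Nat.card_pos.ne')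

/-- The Schmidt graph: the vertices are the prime divisors of `|G|`, and `(p, q)` is an edge iff
`G` contains a Schmidt `(p, q)`-group as a subgroup. -/
def schmidtGraph : GraphFunction.{u} := fun G _ _ =>
  { verts := groupPrimes G
    edges := {e | ∃ H : Subgroup G, IsSchmidtPQGroup e.1 e.2 H}
    edges_subset := by
      rintro ⟨p, q⟩ ⟨H, -, hH, -⟩
      have h := groupPrimes_subgroup_subset H
      rw [hH] at h
      exact ⟨h (Or.inl rfl), h (Or.inr rfl)⟩ }

/-- The soluble radical `G_𝔖`: the subgroup generated by all soluble normal subgroups (for finite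
`G`, the largest soluble normal subgroup). -/
def solubleRadical (G : Type u) [Group G] : Subgroup G :=
  sSup {N : Subgroup G | N.Normal ∧ Group.IsSolvable N}

instance solubleRadical_normal (G : Type u) [Group G] : (solubleRadical G).Normal :=
  Subgroup.sSup_normal _ fun _ hN => hN.1

/-- The Frattini subgroup `Φ(G_𝔖)` of the soluble radical, as a subgroup of `G`. -/
def frattiniSolubleRadical (G : Type u) [Group G] : Subgroup G :=
  (frattini (solubleRadical G)).map (solubleRadical G).subtype

instance frattiniSolubleRadical_normal (G : Type u) [Group G] :
    (frattiniSolubleRadical G).Normal := by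
  unfold frattiniSolubleRadical
  infer_instance

namespace FiniteGroupClass

/-- `F` is solubly saturated: `G / Φ(G_𝔖) ∈ F` implies `G ∈ F`. -/
def IsSolublySaturated (F : FiniteGroupClass.{u}) : Prop :=
  ∀ (G : Type u) [Group G] [Finite G], F.Mem (G ⧸ frattiniSolubleRadical G) → F.Mem G

/-- `G` is `s`-critical for `F`: `G` is not in `F`, but all its proper subgroups are. -/
def IsSCritical (F : FiniteGroupClass.{u}) (G : Type u) [Group G] : Prop :=
  ¬ F.Mem G ∧ ∀ H : Subgroup G, H ≠ ⊤ → F.Mem H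

/-- The Shemetkov property: every finite `s`-critical group is a Schmidt group or has prime
order. -/
def HasShemetkovProperty (F : FiniteGroupClass.{u}) : Prop :=
  ∀ (G : Type u) [Group G] [Finite G],
    F.IsSCritical G → IsSchmidtGroup G ∨ (Nat.card G).Prime

end FiniteGroupClass

/-! ### Nilpotency of finite groups -/

/-! Suppose `F` is recognized. For `H ≤ G ∈ F`, the group `G × H` has the graph of `G`, so it lies
in `F`, and so does its image `H`. If `G` is `s`-critical but neither Schmidt nor of prime order,
the product of its proper subgroups lies in `F` and has the graph of `G`, a contradiction. Soluble
saturation follows from the equality of the graphs of `G` and `G / Φ(G_𝔖)`.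

That equality is the first hard point. Schmidt subgroups lift from quotients through a minimal
supplement. To push a Schmidt subgroup `S` down, pass to the soluble group `H = S G_𝔖`, where
`Φ(G_𝔖) ≤ Φ(H)`. A soluble group has no Schmidt `(p, q)`-subgroup exactly when it has a normal
`p'`-subgroup of index prime to `q`; such a subgroup lifts through a normal subgroup inside `Φ(H)`
by Schur–Zassenhaus and the Frattini argument.

Conversely, let `G₁ ∈ F` and `G₂ ∉ F` have the same graph. An `s`-critical subgroup of `G₂` has
prime order or is a Schmidt `(p, q)`-group. Then `G₁` has a subgroup of the same order, or a Schmidt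
`(p, q)`-subgroup, and heredity puts it in `F`. The second hard point is that one Schmidt `(p,
q)`-group in `F` forces all of them into `F`: modulo a suitable normal subgroup inside the Frattini
subgroup each becomes an irreducible faithful `𝔽_p`-module extended by a group of order `q`, and `p`
and `q` determine this extension up to isomorphism. Schmidt's theorem supplies the pair `(p, q)`. -/

theorem isPGroup_of_groupPrimes_subset {G : Type u} [Group G] [Finite G] {q : ℕ} (hq : q.Prime)
    (h : groupPrimes G ⊆ {q}) : IsPGroup q G := by
  rw [isPGroup_iff_primeFactors_card_subset hq.ne_zero, hq.primeFactors]
  exact fun r hr => by simpa using h hr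

theorem isNilpotent_of_groupPrimes_subset {G : Type u} [Group G] [Finite G] {q : ℕ} (hq : q.Prime)
    (h : groupPrimes G ⊆ {q}) : Group.IsNilpotent G :=
  have := Fact.mk hq
  (isPGroup_of_groupPrimes_subset hq h).isNilpotent

theorem mem_groupPrimes {G : Type u} [Group G] [Finite G] {p : ℕ} :
    p ∈ groupPrimes G ↔ p.Prime ∧ p ∣ Nat.card G := by
  simp [groupPrimes, Nat.card_pos.ne']

theorem prime_of_mem_groupPrimes {G : Type u} [Group G] {p : ℕ} (h : p ∈ groupPrimes G) :
    p.Prime := Nat.prime_of_mem_primeFactors h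

theorem groupPrimes_subset_of_card_dvd {G H : Type*} [Group G] [Group H] [Finite G]
    (h : Nat.card H ∣ Nat.card G) : groupPrimes H ⊆ groupPrimes G :=
  Finset.coe_subset.2 (Nat.primeFactors_mono h Nat.card_pos.ne')

theorem groupPrimes_subset_of_surjective {G H : Type*} [Group G] [Group H] [Finite G] {f : G →* H}
    (hf : Function.Surjective f) : groupPrimes H ⊆ groupPrimes G :=
  groupPrimes_subset_of_card_dvd (Subgroup.card_dvd_of_surjective f hf)

theorem groupPrimes_subset_of_injective {G H : Type*} [Group G] [Group H] [Finite G] {f : H →* G}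
    (hf : Function.Injective f) : groupPrimes H ⊆ groupPrimes G :=
  groupPrimes_subset_of_card_dvd (Subgroup.card_dvd_of_injective f hf)

theorem isNilpotent_of_injective {G H : Type*} [Group G] [Group H] [Group.IsNilpotent H]
    (f : G →* H) (hf : Function.Injective f) : Group.IsNilpotent G :=
  Group.nilpotent_of_mulEquiv (MonoidHom.ofInjective hf).symm

theorem isNilpotent_of_iInf_ker {ι : Type*} [Finite ι] {G : Type*} [Group G] {H : ι → Type*}
    [∀ i, Group (H i)] (f : ∀ i, G →* H i) (hf : ⨅ i, (f i).ker = ⊥)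
    (hn : ∀ i, Group.IsNilpotent (f i).range) : Group.IsNilpotent G := by
  refine isNilpotent_of_injective (H := ∀ i, (f i).range) (MonoidHom.pi fun i => (f i).rangeRestrict) ?_
  rw [← MonoidHom.ker_eq_bot_iff, eq_bot_iff, ← hf]
  intro x hx
  simp only [Subgroup.mem_iInf, MonoidHom.mem_ker] at hx ⊢
  intro i
  exact congrArg Subtype.val (congrFun hx i)

theorem isNilpotent_of_inf_eq_bot {G : Type*} [Group G] {M N : Subgroup G} [M.Normal] [N.Normal]
    (h : M ⊓ N = ⊥) (hM : Group.IsNilpotent (G ⧸ M)) (hN : Group.IsNilpotent (G ⧸ N)) :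
    Group.IsNilpotent G := by
  refine isNilpotent_of_injective
    ((QuotientGroup.mk' M).prod (QuotientGroup.mk' N)) ?_
  rw [← MonoidHom.ker_eq_bot_iff, MonoidHom.ker_prod]
  simpa using h

/-- A finite nilpotent group is the product of its Sylow subgroups, and in each coordinate at least
one of the two elements is trivial. -/
theorem commute_of_coprime_orderOf {G : Type*} [Group G] [Finite G] [hG : Group.IsNilpotent G]
    {x y : G} (h : (orderOf x).Coprime (orderOf y)) : Commute x y := by
  obtain ⟨φ⟩ := ((Group.isNilpotent_of_finite_tfae (G := G)).out 0 4).1 hG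
  suffices Commute (φ.symm x) (φ.symm y) by simpa using this.map φ
  refine Pi.commute_iff.2 fun r => Pi.commute_iff.2 fun P => ?_
  have hr : Fact (r : ℕ).Prime := ⟨Nat.prime_of_mem_primeFactors r.2⟩
  have key : ∀ z : G, orderOf (φ.symm z r P) ∣ orderOf z := fun z =>
    orderOf_dvd_of_pow_eq_one (by
      have : φ.symm z ^ orderOf z = 1 := by rw [← map_pow, pow_orderOf_eq_one, map_one]
      exact congrFun (congrFun this r) P)
  by_cases hx : φ.symm x r P = 1
  · rw [hx]; exact Commute.one_left _
  by_cases hy : φ.symm y r P = 1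
  · rw [hy]; exact Commute.one_right _
  have h1 := ((P.2.dvd_orderOf hx).trans (key x))
  have h2 := ((P.2.dvd_orderOf hy).trans (key y))
  exact absurd (Nat.dvd_gcd h1 h2) (by rw [h]; exact hr.out.not_dvd_one)

theorem isNilpotent_of_sylow_normal {G : Type*} [Group G] [Finite G]
    (h : ∀ (r : ℕ) (_ : Fact r.Prime) (P : Sylow r G), (P : Subgroup G).Normal) :
    Group.IsNilpotent G :=
  ((Group.isNilpotent_of_finite_tfae (G := G)).out 0 3).2 h

theorem isPGroup_quotient_sylow {G : Type u} [Group G] [Finite G] {p q : ℕ} (hp : p.Prime)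
    (hq : q.Prime) (h : groupPrimes G ⊆ {p, q}) (P : Sylow p G) [(P : Subgroup G).Normal] :
    IsPGroup q (G ⧸ (P : Subgroup G)) := by
  have := Fact.mk hp
  refine isPGroup_of_groupPrimes_subset hq fun r hr => ?_
  rcases h (groupPrimes_subset_of_surjective (QuotientGroup.mk'_surjective P.1) hr) with rfl | h
  · exact absurd (mem_groupPrimes.1 hr).2 P.not_dvd_index
  · exact h

/-- Since `P ⊓ K = ⊥`, the group embeds in the product of the `q`-group `G ⧸ P` and the nilpotent
group `G ⧸ K`. -/
theorem isNilpotent_of_coprime_normal {G : Type u} [Group G] [Finite G] {p q : ℕ} (hp : p.Prime)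
    (hq : q.Prime) (h : groupPrimes G ⊆ {p, q}) (P : Sylow p G) [(P : Subgroup G).Normal]
    (K : Subgroup G) [K.Normal] (hpK : ¬ p ∣ Nat.card K) (hK : Group.IsNilpotent (G ⧸ K)) :
    Group.IsNilpotent G := by
  have := Fact.mk hp
  have := Fact.mk hq
  refine isNilpotent_of_inf_eq_bot (M := (P : Subgroup G)) (N := K) ?_
    (isPGroup_quotient_sylow hp hq h P).isNilpotent hK
  refine disjoint_iff.1 (Subgroup.disjoint_of_coprime_natCard ?_)
  obtain ⟨n, hn⟩ := IsPGroup.iff_card.1 P.2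
  rw [hn]
  exact Nat.Coprime.pow_left _ ((Nat.Prime.coprime_iff_not_dvd hp).2 hpK)

theorem sup_sylow_eq_top {p q : ℕ} (hp : p.Prime) (hq : q.Prime) {G : Type*} [Group G] [Finite G]
    (hπ : groupPrimes G ⊆ {p, q}) (P : Sylow p G) (Q : Sylow q G) :
    (P : Subgroup G) ⊔ Q = ⊤ := by
  have := Fact.mk hp
  have := Fact.mk hq
  rw [← Subgroup.index_eq_one]
  by_contra hne
  obtain ⟨r, hr, hrd⟩ := Nat.exists_prime_and_dvd hne
  have hrG : r ∈ groupPrimes G :=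
    mem_groupPrimes.2 ⟨hr, hrd.trans (Subgroup.index_dvd_card _)⟩
  rcases hπ hrG with rfl | rfl
  · exact P.not_dvd_index (hrd.trans (Subgroup.index_dvd_of_le le_sup_left))
  · exact Q.not_dvd_index (hrd.trans (Subgroup.index_dvd_of_le le_sup_right))

/-- The normalizer of `Q` contains both `P` and `Q`, which generate `G`; so `Q` is normal too. -/
theorem isNilpotent_of_sylow_commute {G : Type u} [Group G] [Finite G] {p q : ℕ} (hp : p.Prime)
    (hq : q.Prime) (hpq : p ≠ q) (h : groupPrimes G ⊆ {p, q}) (P : Sylow p G)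
    [(P : Subgroup G).Normal] (Q : Sylow q G) (hc : ∀ x ∈ P, ∀ y ∈ Q, Commute x y) :
    Group.IsNilpotent G := by
  have := Fact.mk hp
  have := Fact.mk hq
  have hPQ := sup_sylow_eq_top hp hq h P Q
  have hQ : (Q : Subgroup G).Normal := by
    rw [← Subgroup.normalizer_eq_top_iff, eq_top_iff, ← hPQ]
    refine sup_le (fun x hx => ?_) Subgroup.le_normalizer
    rw [Subgroup.mem_normalizer_iff]
    intro y
    constructor
    · intro hy
      rwa [(hc x hx y hy).eq, mul_inv_cancel_right]
    · intro hy
      have := (hc x hx _ hy).eq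
      have h2 : y = x * y * x⁻¹ := by
        have h3 : x * (x * y * x⁻¹) * x⁻¹ = x * y * x⁻¹ := by rw [this]; group
        exact mul_left_cancel (mul_right_cancel (b := x⁻¹) (by rw [h3]))
      rwa [h2]
  refine isNilpotent_of_coprime_normal hp hq h P Q ?_ ?_
  · obtain ⟨n, hn⟩ := IsPGroup.iff_card.1 Q.2
    rw [hn]
    intro hd
    exact hpq ((Nat.prime_dvd_prime_iff_eq hp hq).1 (hp.dvd_of_dvd_pow hd))
  · refine (isPGroup_quotient_sylow hq hp ?_ Q).isNilpotent
    rwa [Set.pair_comm]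

/-! ### Schmidt subgroups -/

/-- The group `G` has a Schmidt `(p, q)`-subgroup. -/
def HasSchmidtSubgroup (p q : ℕ) (G : Type u) [Group G] : Prop :=
  ∃ H : Subgroup G, IsSchmidtPQGroup p q H

namespace IsSchmidtPQGroup

variable {p q : ℕ} {S : Type*} [Group S]

theorem finite (h : IsSchmidtPQGroup p q S) : Finite S := h.1.1

theorem not_isNilpotent (h : IsSchmidtPQGroup p q S) : ¬ Group.IsNilpotent S := h.1.2.1

theorem prime_left (h : IsSchmidtPQGroup p q S) : p.Prime :=
  prime_of_mem_groupPrimes (G := S) (h.2.1 ▸ Or.inl rfl)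

theorem prime_right (h : IsSchmidtPQGroup p q S) : q.Prime :=
  prime_of_mem_groupPrimes (G := S) (h.2.1 ▸ Or.inr rfl)

theorem ne (h : IsSchmidtPQGroup p q S) : p ≠ q := by
  rintro rfl
  have := h.finite
  exact h.not_isNilpotent (isNilpotent_of_groupPrimes_subset h.prime_left (by simp [h.2.1]))

end IsSchmidtPQGroup

theorem isSchmidtPQGroup_of_subset {p q : ℕ} (hp : p.Prime) (hq : q.Prime) {T : Type*} [Group T]
    (hT : IsSchmidtGroup T) (hπ : groupPrimes T ⊆ {p, q})
    (hP : ∃ P : Sylow p T, (P : Subgroup T).Normal) : IsSchmidtPQGroup p q T := by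
  have := hT.1
  refine ⟨hT, Set.Subset.antisymm hπ ?_, hP⟩
  rintro r (rfl | rfl)
  · by_contra hr
    refine hT.2.1 (isNilpotent_of_groupPrimes_subset hq fun s hs => ?_)
    rcases hπ hs with rfl | h
    · exact absurd hs hr
    · exact h
  · by_contra hr
    refine hT.2.1 (isNilpotent_of_groupPrimes_subset hp fun s hs => ?_)
    rcases hπ hs with h | h
    · exact h
    · rw [Set.mem_singleton_iff] at h
      exact absurd (h ▸ hs) hr

theorem IsSchmidtGroup.of_surjective {S T : Type*} [Group S] [Group T] (hS : IsSchmidtGroup S)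
    (f : S →* T) (hf : Function.Surjective f) (hT : ¬ Group.IsNilpotent T) : IsSchmidtGroup T := by
  have := hS.1
  refine ⟨Finite.of_surjective f hf, hT, fun H hH => ?_⟩
  have h1 : H.comap f ≠ ⊤ := fun h => hH (by
    rw [← Subgroup.map_comap_eq_self_of_surjective hf H, h, Subgroup.map_top_of_surjective f hf])
  have := hS.2.2 _ h1
  exact Group.nilpotent_of_surjective (f.subgroupComap H)
    (f.subgroupComap_surjective_of_surjective H hf)

theorem IsSchmidtPQGroup.of_surjective {p q : ℕ} {S T : Type*} [Group S] [Group T]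
    (hS : IsSchmidtPQGroup p q S) (f : S →* T) (hf : Function.Surjective f)
    (hT : ¬ Group.IsNilpotent T) : IsSchmidtPQGroup p q T := by
  have := hS.finite
  have := Fact.mk hS.prime_left
  refine isSchmidtPQGroup_of_subset hS.prime_left hS.prime_right (hS.1.of_surjective f hf hT)
    (hS.2.1 ▸ groupPrimes_subset_of_surjective hf) ?_
  obtain ⟨P, hP⟩ := hS.2.2
  exact ⟨P.mapSurjective hf, by rw [Sylow.coe_mapSurjective]; exact hP.map f hf⟩

theorem IsSchmidtPQGroup.of_mulEquiv {p q : ℕ} {S T : Type*} [Group S] [Group T]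
    (hS : IsSchmidtPQGroup p q S) (e : S ≃* T) : IsSchmidtPQGroup p q T :=
  hS.of_surjective e.toMonoidHom e.surjective fun _ =>
    hS.not_isNilpotent (Group.nilpotent_of_mulEquiv e.symm)

theorem IsSchmidtPQGroup.hasSchmidtSubgroup_of_hom {p q : ℕ} {S G : Type*} [Group S] [Group G]
    (hS : IsSchmidtPQGroup p q S) (f : S →* G) (hf : ¬ Group.IsNilpotent f.range) :
    HasSchmidtSubgroup p q G :=
  ⟨f.range, hS.of_surjective f.rangeRestrict f.rangeRestrict_surjective hf⟩

theorem HasSchmidtSubgroup.of_injective {p q : ℕ} {G H : Type*} [Group G] [Group H]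
    (h : HasSchmidtSubgroup p q G) (f : G →* H) (hf : Function.Injective f) :
    HasSchmidtSubgroup p q H := by
  obtain ⟨S, hS⟩ := h
  exact ⟨S.map f, hS.of_mulEquiv (S.equivMapOfInjective f hf)⟩

/-- A Schmidt subgroup embeds in the product of its images, so some image is not nilpotent, and a
non-nilpotent image of a Schmidt `(p, q)`-group is again one. -/
theorem HasSchmidtSubgroup.exists_of_iInf_ker {p q : ℕ} {ι : Type*} [Finite ι] {G : Type*} [Group G]
    {H : ι → Type*} [∀ i, Group (H i)] (f : ∀ i, G →* H i) (hf : ⨅ i, (f i).ker = ⊥)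
    (h : HasSchmidtSubgroup p q G) : ∃ i, HasSchmidtSubgroup p q (H i) := by
  obtain ⟨S, hS⟩ := h
  by_contra! hn
  refine hS.not_isNilpotent (isNilpotent_of_iInf_ker (fun i => (f i).comp S.subtype) ?_ fun i => ?_)
  · rw [eq_bot_iff]
    intro x hx
    have h1 : (x : G) ∈ ⨅ i, (f i).ker := by
      simp only [Subgroup.mem_iInf, MonoidHom.mem_ker] at hx ⊢
      exact hx
    rw [hf] at h1
    exact Subtype.ext h1
  · by_contra h1
    exact hn i (hS.hasSchmidtSubgroup_of_hom _ h1)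

/-- A minimal non-nilpotent subgroup. -/
theorem exists_isSchmidtGroup_of_not_isNilpotent {G : Type*} [Group G] [Finite G]
    (hG : ¬ Group.IsNilpotent G) : ∃ S : Subgroup G, IsSchmidtGroup S := by
  have hne : {H : Subgroup G | ¬ Group.IsNilpotent H}.Nonempty :=
    ⟨⊤, fun _ => hG (Group.nilpotent_of_mulEquiv Subgroup.topEquiv)⟩
  obtain ⟨S, hS⟩ := Set.Finite.exists_minimal (Set.toFinite _) hne
  refine ⟨S, inferInstance, hS.prop, fun H hH => ?_⟩
  by_contra hn
  have h1 : ¬ Group.IsNilpotent (H.map S.subtype) := fun _ =>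
    hn (Group.nilpotent_of_mulEquiv (H.equivMapOfInjective S.subtype S.subtype_injective).symm)
  have h2 : H.map S.subtype = S := le_antisymm (Subgroup.map_subtype_le H)
    (hS.le_of_le h1 (Subgroup.map_subtype_le H))
  refine hH (Subgroup.map_injective S.subtype_injective ?_)
  rw [h2, ← MonoidHom.range_eq_map, Subgroup.range_subtype]

theorem exists_sylow_normal_subgroup {p : ℕ} {G : Type*} [Group G] [Finite G]
    (hp : p.Prime) (P : Sylow p G) [(P : Subgroup G).Normal] (H : Subgroup G) :
    ∃ P' : Sylow p H, (P' : Subgroup H).Normal := by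
  have := Fact.mk hp
  obtain ⟨P'⟩ := (inferInstance : Nonempty (Sylow p H))
  obtain ⟨R, hR⟩ := P'.exists_comap_subtype_eq
  have hPR : R = P := by
    have := (Sylow.unique_of_normal P inferInstance)
    exact Subsingleton.elim R P
  exact ⟨P', by rw [← hR, hPR]; infer_instance⟩

theorem hasSchmidtSubgroup_of_not_isNilpotent {p q : ℕ} (hp : p.Prime) (hq : q.Prime)
    {L : Type*} [Group L] [Finite L] (hL : ¬ Group.IsNilpotent L) (hπ : groupPrimes L ⊆ {p, q})
    (P : Sylow p L) [(P : Subgroup L).Normal] : HasSchmidtSubgroup p q L := by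
  obtain ⟨S, hS⟩ := exists_isSchmidtGroup_of_not_isNilpotent hL
  exact ⟨S, isSchmidtPQGroup_of_subset hp hq hS
    ((groupPrimes_subgroup_subset S).trans hπ) (exists_sylow_normal_subgroup hp P S)⟩

theorem groupPrimes_sup_subset {p q : ℕ} (hp : p.Prime) (hq : q.Prime) {G : Type*} [Group G]
    [Finite G] {P Q : Subgroup G} (hP : IsPGroup p P) (hQ : IsPGroup q Q) [P.Normal] :
    groupPrimes ↥(P ⊔ Q) ⊆ {p, q} := by
  have := Fact.mk hp
  have := Fact.mk hq
  intro r hr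
  obtain ⟨n, hn⟩ := IsPGroup.iff_card.1 hP
  obtain ⟨m, hm⟩ := IsPGroup.iff_card.1 hQ
  obtain ⟨h1, h2⟩ := mem_groupPrimes.1 hr
  have h3 : Nat.card ↥(P ⊔ Q) ∣ p ^ n * q ^ m := by
    rw [← hn, ← hm, ← Subgroup.card_mul_index (P.subgroupOf (P ⊔ Q)),
      Nat.card_congr (Subgroup.subgroupOfEquivOfLe le_sup_left).toEquiv]
    refine mul_dvd_mul_left _ ?_
    change P.relIndex (P ⊔ Q) ∣ _
    rw [Subgroup.relIndex_sup_left]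
    exact Subgroup.relIndex_dvd_card _ _
  rcases (Nat.Prime.dvd_mul h1).1 (h2.trans h3) with h | h
  · exact Or.inl ((Nat.prime_dvd_prime_iff_eq h1 hp).1 (h1.dvd_of_dvd_pow h))
  · exact Or.inr ((Nat.prime_dvd_prime_iff_eq h1 hq).1 (h1.dvd_of_dvd_pow h))

/-- Schmidt `(p, q)`-subgroups of a quotient lift. -/
theorem HasSchmidtSubgroup.of_quotient {p q : ℕ} {G H : Type*} [Group G] [Group H] [Finite G]
    (f : G →* H) (hf : Function.Surjective f) (h : HasSchmidtSubgroup p q H) :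
    HasSchmidtSubgroup p q G := by
  obtain ⟨S, hS⟩ := h
  have hp := hS.prime_left
  have hq := hS.prime_right
  have := Fact.mk hp
  have := Fact.mk hq
  -- Minimality of `L` means that a subgroup of `L` mapping onto the image is all of `L`. This is
  -- applied to the normalizer of `P` and to `P ⊔ Q`.
  obtain ⟨L, hL⟩ := Set.Finite.exists_minimal (Set.toFinite {L : Subgroup G | L.map f = S})
    ⟨S.comap f, Subgroup.map_comap_eq_self_of_surjective hf S⟩
  have hLS : L.map f = S := hL.prop
  subst hLS
  have := hS.finite
  let g : L →* L.map f := f.subgroupMap L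
  have hg : Function.Surjective g := f.subgroupMap_surjective L
  have hmin : ∀ K : Subgroup L, K.map g = ⊤ → K = ⊤ := by
    intro K hK
    have h1 : (K.map L.subtype).map f = L.map f := by
      have : (K.map g).map (L.map f).subtype = L.map f := by
        rw [hK, ← MonoidHom.range_eq_map, Subgroup.range_subtype]
      rw [← this, Subgroup.map_map, Subgroup.map_map]
      rfl
    have h2 := le_antisymm (Subgroup.map_subtype_le K)
      (hL.le_of_le h1 (Subgroup.map_subtype_le K))
    refine Subgroup.map_injective L.subtype_injective ?_
    rw [h2, ← MonoidHom.range_eq_map, Subgroup.range_subtype]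
  obtain ⟨P⟩ := (inferInstance : Nonempty (Sylow p L))
  obtain ⟨Q⟩ := (inferInstance : Nonempty (Sylow q L))
  have hPn : ((P : Subgroup L).map g).Normal := by
    obtain ⟨P', hP'⟩ := hS.2.2
    have := Sylow.unique_of_normal P' hP'
    rw [← Sylow.coe_mapSurjective hg, Subsingleton.elim (P.mapSurjective hg) P']
    exact hP'
  have hP : (P : Subgroup L).Normal := by
    rw [← Subgroup.normalizer_eq_top_iff]
    apply hmin
    -- Frattini argument in the preimage of the normal Sylow subgroup of the image.
    have h1 := Sylow.normalizer_sup_eq_top' (N := ((P : Subgroup L).map g).comap g) P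
      (Subgroup.le_comap_map _ _)
    have h2 := congrArg (Subgroup.map g) h1
    rw [Subgroup.map_sup, Subgroup.map_comap_eq_self_of_surjective hg,
      Subgroup.map_top_of_surjective g hg] at h2
    have h3 : (P : Subgroup L).map g ≤ (Subgroup.normalizer (P : Set L)).map g :=
      Subgroup.map_mono Subgroup.le_normalizer
    rwa [sup_eq_left.2 h3] at h2
  have hPQ : (P : Subgroup L) ⊔ Q = ⊤ := by
    apply hmin
    rw [Subgroup.map_sup, ← Sylow.coe_mapSurjective hg, ← Sylow.coe_mapSurjective hg]
    exact sup_sylow_eq_top hp hq hS.2.1.le _ _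
  have hπ : groupPrimes L ⊆ {p, q} := by
    refine Set.Subset.trans ?_ (groupPrimes_sup_subset hp hq P.2 Q.2)
    rw [hPQ]
    exact groupPrimes_subset_of_injective (f := (Subgroup.topEquiv (G := L)).symm.toMonoidHom)
      (Subgroup.topEquiv (G := L)).symm.injective
  refine (hasSchmidtSubgroup_of_not_isNilpotent hp hq (fun _ => ?_) hπ P).of_injective L.subtype
    L.subtype_injective
  exact hS.not_isNilpotent (Group.nilpotent_of_surjective g hg)

/-! ### Groups without Schmidt `(p, q)`-subgroups -/

section

open scoped Pointwise
open MulAction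

/-- A complement is itself a transversal of `V`, and translation by its own elements does not move
it. -/
theorem le_stabilizer_of_isComplement' {G : Type*} [Group G] [Finite G] {V K : Subgroup G}
    [IsMulCommutative V] [V.Normal] (hK : V.IsComplement' K) :
    ∃ α : V.QuotientDiff, K ≤ stabilizer G α := by
  refine ⟨Quotient.mk'' ⟨(K : Set G), hK.symm⟩, fun k hk => ?_⟩
  refine congrArg Quotient.mk'' (Subtype.ext ?_)
  change MulOpposite.op k⁻¹ • (K : Set G) = K
  exact op_smul_coe_set (K.inv_mem hk)

/-- Complements of a commutative normal Hall subgroup are conjugate. -/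
theorem exists_conj_of_isComplement' {G : Type*} [Group G] [Finite G] {V K₁ K₂ : Subgroup G}
    [IsMulCommutative V] [V.Normal] (hV : (Nat.card V).Coprime V.index)
    (h₁ : V.IsComplement' K₁) (h₂ : V.IsComplement' K₂) : ∃ g : G, MulAut.conj g • K₁ = K₂ := by
  obtain ⟨α, hα⟩ := le_stabilizer_of_isComplement' h₁
  obtain ⟨β, hβ⟩ := le_stabilizer_of_isComplement' h₂
  -- `V` is transitive on the classes of transversals. Stabilizers are complements, so by order they
  -- equal `K₁` and `K₂`; stabilizers in one orbit are conjugate.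
  obtain ⟨h, rfl⟩ := Subgroup.exists_smul_eq hV α β
  have key : ∀ (K : Subgroup G) (γ : V.QuotientDiff), V.IsComplement' K →
      K ≤ stabilizer G γ → K = stabilizer G γ := by
    intro K γ hK hle
    refine Subgroup.eq_of_le_of_card_ge hle (le_of_eq ?_)
    rw [← hK.symm.index_eq_card,
      ← (Subgroup.isComplement'_stabilizer_of_coprime (α := γ) hV).symm.index_eq_card]
  refine ⟨(h : G), ?_⟩
  rw [key K₁ α h₁ hα, key K₂ _ h₂ hβ]
  exact (stabilizer_smul_eq_stabilizer_map_conj (h : G) α).symm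

end

theorem map_subtype_sylow_normal {r : ℕ} {Y : Type*} [Group Y] [Finite Y] (hr : r.Prime)
    (D : Subgroup Y) [D.Normal] (R : Sylow r D) [hR : (R : Subgroup D).Normal] :
    ((R : Subgroup D).map D.subtype).Normal := by
  have := Fact.mk hr
  have := R.characteristic_of_normal hR
  infer_instance

/-- Everything happens in `U ⊔ ⟨y⟩`, a `{p, q}`-group with normal Sylow `p`-subgroup `U`: nilpotency
gives commutation, and its failure gives a Schmidt subgroup. -/
theorem hasSchmidtSubgroup_or_commute {p q : ℕ} (hp : p.Prime) (hq : q.Prime) (hpq : p ≠ q)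
    {G : Type*} [Group G] [Finite G] {U : Subgroup G} [U.Normal] (hU : IsPGroup p U) {y : G}
    (hy : orderOf y = q) : HasSchmidtSubgroup p q G ∨ ∀ u ∈ U, Commute u y := by
  have := Fact.mk hp
  have := Fact.mk hq
  have hQ : IsPGroup q (Subgroup.zpowers y) :=
    IsPGroup.of_card (n := 1) (by rw [Nat.card_zpowers, hy, pow_one])
  by_cases hn : Group.IsNilpotent ↥(U ⊔ Subgroup.zpowers y)
  · right
    intro u hu
    have h1 : Commute (⟨u, Subgroup.mem_sup_left hu⟩ : ↥(U ⊔ Subgroup.zpowers y))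
        ⟨y, Subgroup.mem_sup_right (Subgroup.mem_zpowers y)⟩ := by
      apply commute_of_coprime_orderOf
      rw [Subgroup.orderOf_mk, Subgroup.orderOf_mk, hy]
      obtain ⟨n, hn⟩ := IsPGroup.iff_orderOf.1 hU ⟨u, hu⟩
      rw [Subgroup.orderOf_mk] at hn
      rw [hn]
      exact Nat.Coprime.pow_left _ ((Nat.coprime_primes hp hq).2 hpq)
    exact congrArg Subtype.val h1
  · left
    set L := U ⊔ Subgroup.zpowers y
    have hUL : IsPGroup p (U.subgroupOf L) :=
      hU.of_equiv (Subgroup.subgroupOfEquivOfLe le_sup_left).symm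
    have hind : ¬ p ∣ (U.subgroupOf L).index := by
      have h1 : (U.subgroupOf L).index ∣ q := by
        rw [← hy, ← Nat.card_zpowers]
        change U.relIndex (U ⊔ Subgroup.zpowers y) ∣ _
        rw [Subgroup.relIndex_sup_left]
        exact Subgroup.relIndex_dvd_card _ _
      intro h2
      exact hpq ((Nat.prime_dvd_prime_iff_eq hp hq).1 (h2.trans h1))
    have : (hUL.toSylow hind : Subgroup L).Normal := by
      rw [IsPGroup.toSylow_coe]; infer_instance
    exact (hasSchmidtSubgroup_of_not_isNilpotent hp hq hn (groupPrimes_sup_subset hp hq hU hQ)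
      (hUL.toSylow hind)).of_injective L.subtype L.subtype_injective

theorem isNilpotent_of_commutator_le_center {G : Type*} [Group G]
    (h : commutator G ≤ Subgroup.center G) : Group.IsNilpotent G :=
  Subgroup.isNilpotent_of_ker_le_center (Abelianization.of (G := G))
    (by rwa [Abelianization.ker_of])

/-- In a solvable group without normal `p'`-subgroups, a maximal normal `p`-subgroup contains its
centralizer. -/
theorem centralizer_le_of_maximal {p : ℕ} (hp : p.Prime) {Y : Type*} [Group Y] [Finite Y]
    [Group.IsSolvable Y] (hY : ∀ K : Subgroup Y, K.Normal → ¬ p ∣ Nat.card K → K = ⊥)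
    {U : Subgroup Y} (hU : Maximal (fun U : Subgroup Y => U.Normal ∧ IsPGroup p U) U) :
    Subgroup.centralizer (U : Set Y) ≤ U := by
  have := Fact.mk hp
  have hUn := hU.prop.1
  by_contra hC
  -- By minimality of `D` and solubility, `⁅D, D⁆ ≤ U`, which `D` centralizes; so `D` is nilpotent.
  -- Its Sylow subgroups for primes other than `p` are normal `p'`-subgroups of `Y`, hence trivial,
  -- and the `p`-group `U ⊔ D` contradicts maximality of `U`.
  obtain ⟨D, hD⟩ := Set.Finite.exists_minimal
    (Set.toFinite {D : Subgroup Y | D.Normal ∧ D ≤ Subgroup.centralizer (U : Set Y) ∧ ¬ D ≤ U})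
    ⟨Subgroup.centralizer (U : Set Y), inferInstance, le_rfl, hC⟩
  obtain ⟨hDn, hDC, hDU⟩ := hD.prop
  have hDbot : D ≠ ⊥ := fun h => hDU (h ▸ bot_le)
  have hlt := Group.IsSolvable.commutator_lt_of_ne_bot hDbot
  have hDD : ⁅D, D⁆ ≤ U := by
    by_contra h
    exact hlt.not_ge (hD.le_of_le ⟨inferInstance, hlt.le.trans hDC, h⟩ hlt.le)
  have hnil : Group.IsNilpotent D := by
    apply isNilpotent_of_commutator_le_center
    intro x hx
    have hxU : (x : Y) ∈ U := hDD (by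
      rw [← Subgroup.map_subtype_commutator]
      exact Subgroup.mem_map_of_mem _ hx)
    refine Subgroup.mem_center_iff.2 fun d => Subtype.ext ?_
    exact ((Subgroup.mem_centralizer_iff.1 (hDC d.2)) x hxU).symm
  have hDp : IsPGroup p D := by
    refine isPGroup_of_groupPrimes_subset hp fun r hr => ?_
    obtain ⟨hr, hrd⟩ := mem_groupPrimes.1 hr
    by_contra hrp
    have := Fact.mk hr
    obtain ⟨R⟩ := (inferInstance : Nonempty (Sylow r D))
    have hRn := map_subtype_sylow_normal hr D R
    have hcard : Nat.card ((R : Subgroup D).map D.subtype) = Nat.card R :=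
      Nat.card_congr ((R : Subgroup D).equivMapOfInjective D.subtype
        D.subtype_injective).toEquiv.symm
    have hb := hY _ hRn (by
      rw [hcard]
      obtain ⟨n, hn⟩ := IsPGroup.iff_card.1 R.2
      rw [hn]
      intro hd
      exact hrp ((Nat.prime_dvd_prime_iff_eq hp hr).1 (hp.dvd_of_dvd_pow hd)).symm)
    rw [Subgroup.map_eq_bot_iff_of_injective _ D.subtype_injective] at hb
    exact R.ne_bot_of_dvd_card hrd hb
  exact hDU (le_sup_right.trans
    (hU.le_of_ge ⟨inferInstance, hU.prop.2.to_sup_of_normal_right hDp⟩ le_sup_left))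

/-- An element of order `q` would centralize the maximal normal `p`-subgroup, hence lie in it. -/
theorem not_dvd_card_of_not_hasSchmidtSubgroup {p q : ℕ} (hp : p.Prime) (hq : q.Prime)
    (hpq : p ≠ q) {Y : Type*} [Group Y] [Finite Y] [Group.IsSolvable Y]
    (hY : ∀ K : Subgroup Y, K.Normal → ¬ p ∣ Nat.card K → K = ⊥)
    (hS : ¬ HasSchmidtSubgroup p q Y) : ¬ q ∣ Nat.card Y := by
  intro hqd
  have := Fact.mk hp
  have := Fact.mk hq
  obtain ⟨U, hU⟩ := Set.Finite.exists_maximal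
    (Set.toFinite {U : Subgroup Y | U.Normal ∧ IsPGroup p U})
    ⟨⊥, inferInstance, IsPGroup.of_bot⟩
  obtain ⟨y, hy⟩ := exists_prime_orderOf_dvd_card' q hqd
  have hUn := hU.prop.1
  have hc := (hasSchmidtSubgroup_or_commute hp hq hpq hU.prop.2 hy).resolve_left hS
  have hyU : y ∈ U := centralizer_le_of_maximal hp hY hU
    (Subgroup.mem_centralizer_iff.2 fun u hu => hc u hu)
  obtain ⟨n, hn⟩ := IsPGroup.iff_orderOf.1 hU.prop.2 ⟨y, hyU⟩
  rw [Subgroup.orderOf_mk, hy] at hn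
  exact hpq ((Nat.prime_dvd_prime_iff_eq hq hp).1 (hq.dvd_of_dvd_pow hn.dvd)).symm

theorem card_comap_mk' {G : Type*} [Group G] [Finite G] (A : Subgroup G) [A.Normal] (K : Subgroup (G ⧸ A)) :
    Nat.card (K.comap (QuotientGroup.mk' A)) = Nat.card A * Nat.card K := by
  have h1 := (K.comap (QuotientGroup.mk' A)).card_mul_index
  rw [Subgroup.index_comap_of_surjective _ (QuotientGroup.mk'_surjective A),
    ← A.card_mul_index, A.index_eq_card, ← K.card_mul_index, ← mul_assoc] at h1
  exact mul_right_cancel₀ K.index_ne_zero_of_finite h1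

/-- A solvable group without Schmidt `(p, q)`-subgroups is an extension of a `p'`-group by a
`q'`-group. -/
theorem exists_normal_of_not_hasSchmidtSubgroup {p q : ℕ} (hp : p.Prime) (hq : q.Prime)
    (hpq : p ≠ q) {X : Type*} [Group X] [Finite X] [Group.IsSolvable X]
    (hS : ¬ HasSchmidtSubgroup p q X) :
    ∃ A : Subgroup X, A.Normal ∧ ¬ p ∣ Nat.card A ∧ ¬ q ∣ A.index := by
  obtain ⟨A, hA⟩ := Set.Finite.exists_maximal
    (Set.toFinite {A : Subgroup X | A.Normal ∧ ¬ p ∣ Nat.card A})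
    ⟨⊥, inferInstance, by simpa using hp.ne_one⟩
  have hAn := hA.prop.1
  refine ⟨A, hAn, hA.prop.2, ?_⟩
  rw [Subgroup.index_eq_card]
  refine not_dvd_card_of_not_hasSchmidtSubgroup hp hq hpq (fun K hK hpK => ?_)
    fun h => hS (h.of_quotient _ (QuotientGroup.mk'_surjective A))
  have h1 : K.comap (QuotientGroup.mk' A) ≤ A := by
    refine hA.le_of_ge ⟨inferInstance, ?_⟩ ?_
    · rw [card_comap_mk', hp.dvd_mul]
      exact fun h => h.elim hA.prop.2 hpK
    · exact (QuotientGroup.ker_mk' A).ge.trans (Subgroup.ker_le_comap _ _)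
  rw [eq_bot_iff, ← Subgroup.map_comap_eq_self_of_surjective (QuotientGroup.mk'_surjective A) K]
  refine (Subgroup.map_mono h1).trans ?_
  rw [QuotientGroup.map_mk'_self]

theorem IsSchmidtPQGroup.not_isNilpotent_quotient_of_normal {p q : ℕ} {H : Type*} [Group H] [Finite H]
    {S : Subgroup H} (hS : IsSchmidtPQGroup p q S) (K : Subgroup H) [K.Normal]
    (hpK : ¬ p ∣ Nat.card K) : ¬ Group.IsNilpotent (S ⧸ K.subgroupOf S) := by
  intro hn
  obtain ⟨P, hP⟩ := hS.2.2
  refine hS.not_isNilpotent (isNilpotent_of_coprime_normal hS.prime_left hS.prime_right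
    hS.2.1.le P (K.subgroupOf S) (fun h => hpK (h.trans ?_)) hn)
  exact Subgroup.card_comap_dvd_of_injective K S.subtype S.subtype_injective

/-- Converse of `exists_normal_of_not_hasSchmidtSubgroup`: `S / (S ∩ K)` would be a `p`-group,
making `S` nilpotent. -/
theorem not_hasSchmidtSubgroup_of_normal {p q : ℕ} {H : Type*} [Group H] [Finite H]
    (K : Subgroup H) [K.Normal] (hpK : ¬ p ∣ Nat.card K) (hqK : ¬ q ∣ K.index) :
    ¬ HasSchmidtSubgroup p q H := by
  rintro ⟨S, hS⟩
  refine hS.not_isNilpotent_quotient_of_normal K hpK ?_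
  refine isNilpotent_of_groupPrimes_subset hS.prime_left fun r hr => ?_
  rcases hS.2.1.le (groupPrimes_subset_of_surjective (QuotientGroup.mk'_surjective _) hr)
    with h | rfl
  · exact h
  · exact absurd ((mem_groupPrimes.1 hr).2.trans (Subgroup.relIndex_dvd_index_of_normal K S)) hqK

/-! ### Frattini subgroups of normal subgroups -/

section

open scoped Pointwise

/-- If a maximal `M` misses `Φ(D)`, then `M Φ(D) = H`, so `D = (M ∩ D) Φ(D)` by Dedekind's law,
whence `D ≤ M`, a contradiction. -/
theorem map_frattini_le_frattini {H : Type*} [Group H] [Finite H] (D : Subgroup H)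
    [D.Normal] : (frattini D).map D.subtype ≤ frattini H := by
  refine le_iInf₂ fun M hM => ?_
  by_contra hF
  have hMF : M ⊔ (frattini D).map D.subtype = ⊤ := hM.2 _ (left_lt_sup.2 hF)
  have hD : M.subgroupOf D = ⊤ := by
    by_contra hne
    obtain ⟨C, hC, hMC⟩ := (eq_top_or_exists_le_coatom (M.subgroupOf D)).resolve_left hne
    refine hC.1 (eq_top_iff.2 fun d _ => ?_)
    obtain ⟨m, hm, _, ⟨f, hf, rfl⟩, hd⟩ :=
      Subgroup.mem_sup_of_normal_right.1 (hMF.ge (Subgroup.mem_top (d : H)))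
    have hmd : m = ((d * f⁻¹ : D) : H) := by
      rw [← mul_inv_eq_iff_eq_mul.2 hd.symm]; rfl
    have h1 : d * f⁻¹ ∈ C := hMC (by rw [Subgroup.mem_subgroupOf, ← hmd]; exact hm)
    simpa using C.mul_mem h1 (frattini_le_coatom hC hf)
  exact hF ((Subgroup.map_subtype_le _).trans (Subgroup.subgroupOf_eq_top.1 hD))

theorem map_frattini_le_frattini_of_normal_range {R H : Type*} [Group R] [Group H] [Finite H]
    (i : R →* H) (hn : i.range.Normal) : (frattini R).map i ≤ frattini H := by
  refine le_trans ?_ (map_frattini_le_frattini i.range)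
  rintro _ ⟨x, hx, rfl⟩
  exact ⟨i.rangeRestrict x,
    frattini_le_comap_frattini_of_surjective i.rangeRestrict_surjective hx, rfl⟩

/-- Otherwise the Sylow `p`-subgroup `T` of the nilpotent group `Φ(R)` is a normal Sylow subgroup of
`R`. A complement of `T` supplements `Φ(R)`, so it is all of `R` and `T` is trivial. -/
theorem dvd_index_frattini {R : Type*} [Group R] [Finite R] {p : ℕ} (hp : p.Prime)
    (hpR : p ∣ Nat.card R) : p ∣ (frattini R).index := by
  have := Fact.mk hp
  by_contra hpi
  have := frattini_nilpotent (G := R)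
  obtain ⟨P⟩ := (inferInstance : Nonempty (Sylow p (frattini R)))
  have hTn := map_subtype_sylow_normal hp (frattini R) P
  set T := (P : Subgroup (frattini R)).map (frattini R).subtype with hT
  have hTp : IsPGroup p T := P.2.map _
  have hTi : ¬ p ∣ T.index := by
    rw [hT, Subgroup.index_map_subtype, hp.dvd_mul]
    exact fun h => h.elim P.not_dvd_index hpi
  obtain ⟨n, hn⟩ := IsPGroup.iff_card.1 hTp
  obtain ⟨K, hK⟩ := Subgroup.exists_right_complement'_of_coprime (N := T)
    (by rw [hn]; exact Nat.Coprime.pow_left _ ((Nat.Prime.coprime_iff_not_dvd hp).2 hTi))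
  have hKtop : K = ⊤ := frattini_nongenerating (eq_top_iff.2 (by
    rw [← hK.sup_eq_top, sup_comm]
    exact sup_le_sup_left (Subgroup.map_subtype_le _) _))
  rw [hKtop, Subgroup.isComplement'_top_right] at hK
  rw [hK, Subgroup.index_bot] at hTi
  exact hTi hpR

/-! ### Schmidt subgroups modulo subgroups of the Frattini subgroup -/

theorem mem_normalizer_of_conj_smul_eq {G : Type*} [Group G] {K : Subgroup G} {g : G}
    (h : MulAut.conj g • K = K) : g ∈ Subgroup.normalizer (K : Set G) := by
  rw [Subgroup.mem_normalizer_iff]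
  intro x
  conv_rhs => rw [← h, ← MulAut.conj_apply, ← MulAut.smul_def]
  exact Subgroup.smul_mem_pointwise_smul_iff.symm

/-- If `V ≤ Φ(H)` is a commutative normal `p`-subgroup and `A/V` is a normal `p'`-subgroup of `H/V`,
then the complements of `V` in `A` are normal in `H`. -/
theorem exists_normal_complement {p : ℕ} (hp : p.Prime) {H : Type*} [Group H] [Finite H]
    (V A : Subgroup H) [V.Normal] [A.Normal] [IsMulCommutative V] (hV : V ≤ frattini H)
    (hVA : V ≤ A) (hVp : IsPGroup p V) (hpA : ¬ p ∣ (V.subgroupOf A).index) :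
    ∃ K : Subgroup H, K.Normal ∧ Nat.card K = (V.subgroupOf A).index := by
  have := Fact.mk hp
  have hVcard : Nat.card (V.subgroupOf A) = Nat.card V :=
    Nat.card_congr (Subgroup.subgroupOfEquivOfLe hVA).toEquiv
  obtain ⟨n, hn⟩ := IsPGroup.iff_card.1 hVp
  have hcop : (Nat.card (V.subgroupOf A)).Coprime (V.subgroupOf A).index := by
    rw [hVcard, hn]
    exact Nat.Coprime.pow_left _ ((Nat.Prime.coprime_iff_not_dvd hp).2 hpA)
  have hcomm : IsMulCommutative (V.subgroupOf A) := by
    infer_instance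
  obtain ⟨K, hK⟩ := Subgroup.exists_right_complement'_of_coprime (N := V.subgroupOf A) hcop
  have hKcard := hK.symm.index_eq_card
  have hcK : Nat.card (K.map A.subtype) = Nat.card K :=
    Nat.card_congr (K.equivMapOfInjective A.subtype A.subtype_injective).toEquiv.symm
  refine ⟨K.map A.subtype, ?_, by rw [hKcard, hcK]⟩
  rw [← Subgroup.normalizer_eq_top_iff]
  set N := Subgroup.normalizer ((K.map A.subtype : Subgroup H) : Set H) with hN
  -- As `V ≤ Φ(H)`, it can be dropped from a generating set. The remaining claim is a Frattini
  -- argument: an `H`-conjugate of `K` is a complement of `V` in `A`, hence already conjugate to `K`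
  -- in `A`.
  suffices h : N ⊔ V = ⊤ from
    frattini_nongenerating (eq_top_iff.2 (h.ge.trans (sup_le_sup_left hV _)))
  have hA : A ≤ N ⊔ V := by
    have h1 := congrArg (Subgroup.map A.subtype) hK.sup_eq_top
    rw [← MonoidHom.range_eq_map, Subgroup.range_subtype, Subgroup.map_sup] at h1
    rw [← h1, sup_comm]
    exact sup_le_sup Subgroup.le_normalizer (Subgroup.map_comap_le _ _)
  rw [eq_top_iff]
  intro h _
  have hK2 : (V.subgroupOf A).IsComplement' (MulAut.conjNormal (H := A) h • K) := by
    have h2 : Nat.card ↥(MulAut.conjNormal (H := A) h • K) = Nat.card K :=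
      Nat.card_congr (Subgroup.equivSMul _ K).toEquiv.symm
    refine Subgroup.isComplement'_of_coprime ?_ ?_
    · rw [h2, hK.card_mul_card]
    · rw [h2, ← hKcard]; exact hcop
  obtain ⟨a, ha⟩ := exists_conj_of_isComplement' (V := V.subgroupOf A) hcop hK hK2
  have hmap : MulAut.conj (a : H) • K.map A.subtype = MulAut.conj h • K.map A.subtype := by
    have h3 := congrArg (Subgroup.map A.subtype) ha
    have h4 : ∀ (φ : MulAut A) (x : H), (∀ y : A, ((φ y : A) : H) = x * y * x⁻¹) →
        (φ • K).map A.subtype = MulAut.conj x • K.map A.subtype := by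
      intro φ x hx
      ext z
      constructor
      · rintro ⟨_, ⟨y, hy, rfl⟩, rfl⟩
        exact ⟨y, ⟨y, hy, rfl⟩, (hx y).symm⟩
      · rintro ⟨_, ⟨y, hy, rfl⟩, rfl⟩
        exact ⟨φ y, ⟨y, hy, rfl⟩, hx y⟩
    rw [h4 _ (a : H) (fun y => by simp), h4 _ h (fun y => by simp)] at h3
    exact h3
  have hmem : (a : H)⁻¹ * h ∈ N := by
    apply mem_normalizer_of_conj_smul_eq
    rw [map_mul, mul_smul, ← hmap, ← mul_smul, ← map_mul, inv_mul_cancel, map_one, one_smul]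
  have := (N ⊔ V).mul_mem (hA a.2) (Subgroup.mem_sup_left (T := V) hmem)
  rwa [mul_inv_cancel_left] at this

end

/-- Contrapositive: a normal `p'`-subgroup `B` of `H ⧸ V` with index prime to `q` lifts to a normal
`K` of the same order, whose index grows only by the `p`-power `|V|`. -/
theorem HasSchmidtSubgroup.quotient_of_isPGroup {p q : ℕ} {H : Type*} [Group H] [Finite H]
    [Group.IsSolvable H] (V : Subgroup H) [V.Normal] [IsMulCommutative V] (hV : V ≤ frattini H)
    (hVp : IsPGroup p V) (h : HasSchmidtSubgroup p q H) : HasSchmidtSubgroup p q (H ⧸ V) := by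
  obtain ⟨S, hS⟩ := id h
  have hp := hS.prime_left
  have hq := hS.prime_right
  have hpq := hS.ne
  have := Fact.mk hp
  by_contra hn
  obtain ⟨B, hB, hpB, hqB⟩ := exists_normal_of_not_hasSchmidtSubgroup hp hq hpq hn
  set A := B.comap (QuotientGroup.mk' V) with hA
  have hVA : V ≤ A := (QuotientGroup.ker_mk' V).ge.trans (Subgroup.ker_le_comap _ _)
  have hAcard : Nat.card A = Nat.card V * Nat.card B := card_comap_mk' V B
  have hVi : (V.subgroupOf A).index = Nat.card B := by
    have h1 := (V.subgroupOf A).card_mul_index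
    rw [Nat.card_congr (Subgroup.subgroupOfEquivOfLe hVA).toEquiv, hAcard] at h1
    exact mul_left_cancel₀ Nat.card_pos.ne' h1
  obtain ⟨K, hK, hKc⟩ := exists_normal_complement hp V A hV hVA hVp (hVi ▸ hpB)
  rw [hVi] at hKc
  refine not_hasSchmidtSubgroup_of_normal K (hKc ▸ hpB) (fun hqK => ?_) h
  have h2 := K.card_mul_index
  rw [← A.card_mul_index, hAcard, hKc, mul_comm (Nat.card V), mul_assoc] at h2
  have h3 := mul_left_cancel₀ Nat.card_pos.ne' h2
  rw [h3, hA, Subgroup.index_comap_of_surjective _ (QuotientGroup.mk'_surjective V)] at hqK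
  obtain ⟨n, hn⟩ := IsPGroup.iff_card.1 hVp
  rw [hn, hq.dvd_mul] at hqK
  exact hqK.elim
    (fun h => hpq ((Nat.prime_dvd_prime_iff_eq hq hp).1 (hq.dvd_of_dvd_pow h)).symm) hqB

theorem IsSchmidtPQGroup.not_isNilpotent_map {p q : ℕ} {H : Type*} [Group H] [Finite H]
    {S : Subgroup H} (hS : IsSchmidtPQGroup p q S) (K : Subgroup H) [K.Normal]
    (hpK : ¬ p ∣ Nat.card K) :
    ¬ Group.IsNilpotent ((QuotientGroup.mk' K).comp S.subtype).range := by
  intro hn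
  refine hS.not_isNilpotent_quotient_of_normal K hpK ?_
  have e := QuotientGroup.quotientKerEquivRange ((QuotientGroup.mk' K).comp S.subtype)
  have hk : ((QuotientGroup.mk' K).comp S.subtype).ker = K.subgroupOf S := by
    rw [← MonoidHom.comap_ker, QuotientGroup.ker_mk']; rfl
  exact Group.nilpotent_of_mulEquiv (e.symm.trans (QuotientGroup.quotientMulEquivOfEq hk))

theorem exists_minimal_normal_le {H : Type*} [Group H] [Finite H] {N : Subgroup H} [N.Normal]
    (hN : N ≠ ⊥) : ∃ V ≤ N, Minimal (fun V : Subgroup H => V.Normal ∧ V ≠ ⊥) V :=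
  Set.Finite.exists_le_minimal (Set.toFinite {V : Subgroup H | V.Normal ∧ V ≠ ⊥})
    ⟨inferInstance, hN⟩

theorem isMulCommutative_of_minimal_normal {H : Type*} [Group H] [Group.IsSolvable H]
    {V : Subgroup H} (hV : Minimal (fun V : Subgroup H => V.Normal ∧ V ≠ ⊥) V) :
    IsMulCommutative V := by
  have := hV.prop.1
  have hlt := Group.IsSolvable.commutator_lt_of_ne_bot hV.prop.2
  have hb : ⁅V, V⁆ = ⊥ := by
    by_contra h
    exact hlt.not_ge (hV.le_of_le ⟨inferInstance, h⟩ hlt.le)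
  rwa [Subgroup.commutator_eq_bot_iff_le_centralizer, Subgroup.le_centralizer_iff_isMulCommutative]
    at hb

theorem isPGroup_of_minimal_normal {p : ℕ} (hp : p.Prime) {H : Type*} [Group H] [Finite H]
    {V : Subgroup H} [IsMulCommutative V]
    (hV : Minimal (fun V : Subgroup H => V.Normal ∧ V ≠ ⊥) V) (hpV : p ∣ Nat.card V) :
    IsPGroup p V := by
  have := Fact.mk hp
  have := hV.prop.1
  obtain ⟨R⟩ := (inferInstance : Nonempty (Sylow p V))
  have hRn : (R : Subgroup V).Normal := inferInstance
  have hn := map_subtype_sylow_normal hp V R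
  have hne : (R : Subgroup V).map V.subtype ≠ ⊥ := by
    rw [Ne, Subgroup.map_eq_bot_iff_of_injective _ V.subtype_injective]
    exact R.ne_bot_of_dvd_card hpV
  exact (R.2.map V.subtype).to_le (hV.le_of_le ⟨hn, hne⟩ (Subgroup.map_subtype_le _))

/-- Induction on `|H|`, factoring out a minimal normal `V ≤ N`. If `V` is a `p'`-group, `S` keeps a
non-nilpotent image; otherwise `V` is an abelian `p`-group. -/
theorem HasSchmidtSubgroup.quotient_of_le_frattini {p q : ℕ} (n : ℕ) :
    ∀ {H : Type u} [Group H] [Finite H] [Group.IsSolvable H] (N : Subgroup H) [N.Normal],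
      Nat.card H = n → N ≤ frattini H → HasSchmidtSubgroup p q H →
        HasSchmidtSubgroup p q (H ⧸ N) := by
  induction n using Nat.strong_induction_on with
  | _ n ih =>
    intro H _ _ _ N _ hn hN h
    by_cases hNb : N = ⊥
    · subst hNb
      exact h.of_injective QuotientGroup.quotientBot.symm.toMonoidHom
        QuotientGroup.quotientBot.symm.injective
    obtain ⟨V, hVN, hV⟩ := exists_minimal_normal_le hNb
    have hVn := hV.prop.1
    have hVc := isMulCommutative_of_minimal_normal hV
    have h1 : HasSchmidtSubgroup p q (H ⧸ V) := by
      obtain ⟨S, hS⟩ := id h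
      by_cases hpV : p ∣ Nat.card V
      · exact h.quotient_of_isPGroup V (hVN.trans hN)
          (isPGroup_of_minimal_normal hS.prime_left hV hpV)
      · exact hS.hasSchmidtSubgroup_of_hom _ (hS.not_isNilpotent_map V hpV)
    have hlt : Nat.card (H ⧸ V) < n := by
      rw [← hn, ← V.card_mul_index, ← V.index_eq_card]
      exact lt_mul_of_one_lt_left (Nat.pos_of_ne_zero V.index_ne_zero_of_finite)
        (Finite.one_lt_card_iff_nontrivial.2 ((Subgroup.nontrivial_iff_ne_bot V).2 hV.prop.2))
    have h2 := ih _ hlt (N.map (QuotientGroup.mk' V)) rfl (Subgroup.map_le_iff_le_comap.2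
      (hN.trans (frattini_le_comap_frattini_of_surjective (QuotientGroup.mk'_surjective V)))) h1
    exact h2.of_injective (QuotientGroup.quotientQuotientEquivQuotient V N hVN).toMonoidHom
      (QuotientGroup.quotientQuotientEquivQuotient V N hVN).injective

/-! ### The soluble radical -/

theorem isSolvable_sup {G : Type*} [Group G] (M N : Subgroup G) [M.Normal]
    (hM : Group.IsSolvable M) (hN : Group.IsSolvable N) : Group.IsSolvable ↥(N ⊔ M) := by
  rw [Group.isSolvable_iff_subgroup_quotient (M.subgroupOf (N ⊔ M))]
  exact ⟨Group.isSolvable_of_isSolvable_injective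
      (f := (Subgroup.subgroupOfEquivOfLe (le_sup_right : M ≤ N ⊔ M)).toMonoidHom)
      (Subgroup.subgroupOfEquivOfLe (le_sup_right : M ≤ N ⊔ M)).injective,
    Group.isSolvable_of_surjective
      (f := (QuotientGroup.quotientInfEquivProdNormalQuotient N M).toMonoidHom)
      (QuotientGroup.quotientInfEquivProdNormalQuotient N M).surjective⟩

theorem isSolvable_solubleRadical (G : Type*) [Group G] [Finite G] :
    Group.IsSolvable (solubleRadical G) := by
  obtain ⟨M, hM⟩ := Set.Finite.exists_maximal
    (Set.toFinite {M : Subgroup G | M.Normal ∧ Group.IsSolvable M})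
    ⟨⊥, inferInstance, inferInstance⟩
  obtain ⟨hMn, hMs⟩ := hM.prop
  have hle : solubleRadical G ≤ M := sSup_le fun N hN =>
    have := hN.1
    le_sup_left.trans (hM.le_of_ge ⟨inferInstance, isSolvable_sup M N hMs hN.2⟩ le_sup_right)
  exact Group.isSolvable_of_isSolvable_injective (Subgroup.inclusion_injective hle)

theorem solubleRadical_eq_top {G : Type*} [Group G] (h : Group.IsSolvable G) :
    solubleRadical G = ⊤ :=
  top_le_iff.1 (le_sSup ⟨inferInstance, Group.isSolvable_of_surjective
    (f := (Subgroup.topEquiv (G := G)).symm.toMonoidHom) (Subgroup.topEquiv (G := G)).symm.surjective⟩)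

theorem IsSchmidtPQGroup.isSolvable {p q : ℕ} {S : Type*} [Group S] (hS : IsSchmidtPQGroup p q S) :
    Group.IsSolvable S := by
  have := hS.finite
  have := Fact.mk hS.prime_left
  have := Fact.mk hS.prime_right
  obtain ⟨P, hP⟩ := hS.2.2
  have h1 := P.2.isNilpotent
  have h2 := (isPGroup_quotient_sylow hS.prime_left hS.prime_right hS.2.1.le P).isNilpotent
  exact (Group.isSolvable_iff_subgroup_quotient (P : Subgroup S)).2 ⟨inferInstance, inferInstance⟩

theorem HasSchmidtSubgroup.quotient_frattiniSolubleRadical {p q : ℕ} {G : Type*} [Group G]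
    [Finite G] (h : HasSchmidtSubgroup p q G) :
    HasSchmidtSubgroup p q (G ⧸ frattiniSolubleRadical G) := by
  obtain ⟨S, hS⟩ := h
  set R := solubleRadical G
  have hR := isSolvable_solubleRadical G
  have hH := isSolvable_sup R S hR hS.isSolvable
  set H := S ⊔ R
  have hSH : HasSchmidtSubgroup p q H :=
    HasSchmidtSubgroup.of_injective (G := S) ⟨⊤, hS.of_mulEquiv Subgroup.topEquiv.symm⟩
      (Subgroup.inclusion le_sup_left) (Subgroup.inclusion_injective _)
  have hle : (frattiniSolubleRadical G).subgroupOf H ≤ frattini H := by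
    refine le_trans ?_ (map_frattini_le_frattini_of_normal_range
      (Subgroup.inclusion (le_sup_right : R ≤ H)) ?_)
    · rintro ⟨x, hx⟩ ⟨y, hy, hyx⟩
      exact ⟨y, hy, Subtype.ext hyx⟩
    · rw [Subgroup.inclusion_range]; infer_instance
  have h1 := hSH.quotient_of_le_frattini (Nat.card H) _ rfl hle
  refine h1.of_injective (QuotientGroup.map _ _ H.subtype
    (fun _ h => h)) ?_
  rw [injective_iff_map_eq_one]
  rintro ⟨x⟩ hx
  exact (QuotientGroup.eq_one_iff x).2 ((QuotientGroup.eq_one_iff (x : G)).1 hx)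

theorem schmidtGraph_quotient_frattiniSolubleRadical (G : Type u) [Group G] [Finite G] :
    schmidtGraph (G ⧸ frattiniSolubleRadical G) = schmidtGraph G := by
  have hs := QuotientGroup.mk'_surjective (frattiniSolubleRadical G)
  refine NatDigraph.ext (Set.Subset.antisymm (groupPrimes_subset_of_surjective hs) ?_)
    (Set.ext fun e => ⟨fun h => HasSchmidtSubgroup.of_quotient _ hs h, fun h =>
      HasSchmidtSubgroup.quotient_frattiniSolubleRadical h⟩)
  intro p hp
  obtain ⟨hp, hpG⟩ := mem_groupPrimes.1 hp
  refine mem_groupPrimes.2 ⟨hp, ?_⟩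
  rw [← Subgroup.index_eq_card]
  rw [← (frattiniSolubleRadical G).card_mul_index] at hpG
  refine (hp.dvd_mul.1 hpG).elim (fun h => ?_) id
  have h1 : p ∣ Nat.card (solubleRadical G) := h.trans (Subgroup.card_dvd_of_le
    (Subgroup.map_subtype_le _))
  rw [frattiniSolubleRadical, Subgroup.index_map_subtype]
  exact (dvd_index_frattini hp h1).mul_right _

/-! ### Groups all of whose proper subgroups are nilpotent -/

theorem lt_normalizer_inf {G : Type*} [Group G] {I M : Subgroup G} (hM : Group.IsNilpotent M)
    (hIM : I < M) : I < Subgroup.normalizer (I : Set G) ⊓ M := by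
  have h1 : I.subgroupOf M < ⊤ := by
    rw [lt_top_iff_ne_top, Ne, Subgroup.subgroupOf_eq_top]
    exact hIM.not_ge
  obtain ⟨x, hx, hxI⟩ := SetLike.exists_of_lt (Group.normalizerCondition_of_isNilpotent _ h1)
  refine lt_of_le_of_ne (le_inf Subgroup.le_normalizer hIM.le) fun h => hxI ?_
  rw [Subgroup.mem_subgroupOf, h]
  refine ⟨Subgroup.mem_normalizer_iff.2 fun y => ?_, x.2⟩
  have h2 := Subgroup.mem_normalizer_iff.1 hx
  constructor
  · intro hy
    exact (h2 ⟨y, hIM.le hy⟩).1 hy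
  · intro hy
    have h3 : (x : G)⁻¹ * (x * y * (x : G)⁻¹) * x ∈ M :=
      M.mul_mem (M.mul_mem (M.inv_mem x.2) (hIM.le hy)) x.2
    have h4 : y ∈ M := by simpa [mul_assoc] using h3
    exact (h2 ⟨y, h4⟩).2 hy

/-- Take a maximal nontrivial intersection `I = L₁ ⊓ L₂`. Its normalizer lies in some maximal `M`.
Normalizers grow in the nilpotent `Lᵢ`, so `M ⊓ Lᵢ` exceeds `I` and `M = L₁ = L₂`. -/
theorem isCoatom_inf_eq_bot {G : Type*} [Group G] [Finite G]
    (hG : ∀ H : Subgroup G, H ≠ ⊤ → Group.IsNilpotent H)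
    (hs : ∀ N : Subgroup G, N.Normal → N = ⊥ ∨ N = ⊤) {M₁ M₂ : Subgroup G} (h₁ : IsCoatom M₁)
    (h₂ : IsCoatom M₂) (hne : M₁ ≠ M₂) : M₁ ⊓ M₂ = ⊥ := by
  by_contra hb
  obtain ⟨I, hI⟩ := Set.Finite.exists_maximal
    (Set.toFinite {I : Subgroup G | I ≠ ⊥ ∧ ∃ M₁ M₂ : Subgroup G, IsCoatom M₁ ∧ IsCoatom M₂ ∧
      M₁ ≠ M₂ ∧ I = M₁ ⊓ M₂}) ⟨_, hb, M₁, M₂, h₁, h₂, hne, rfl⟩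
  obtain ⟨hIb, L₁, L₂, hL₁, hL₂, hL, hIL⟩ := hI.prop
  have hIL₁ : I < L₁ := lt_of_le_of_ne (hIL ▸ inf_le_left) fun h =>
    hL ((hL₁.le_iff_eq hL₂.1).1 (h.ge.trans (hIL ▸ inf_le_right))).symm
  have hIL₂ : I < L₂ := lt_of_le_of_ne (hIL ▸ inf_le_right) fun h =>
    hL ((hL₂.le_iff_eq hL₁.1).1 (h.ge.trans (hIL ▸ inf_le_left)))
  have hN : Subgroup.normalizer (I : Set G) ≠ ⊤ := by
    rw [Ne, Subgroup.normalizer_eq_top_iff]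
    intro h
    exact (hs I h).elim hIb (fun h => hL₁.1 (top_le_iff.1 (h ▸ hIL₁.le)))
  obtain ⟨M, hM, hNM⟩ := (eq_top_or_exists_le_coatom _).resolve_left hN
  have key : ∀ L, IsCoatom L → I < L → M = L := by
    intro L hL hIL
    by_contra hML
    have h1 := lt_normalizer_inf (hG L hL.1) hIL
    have h2 : I < M ⊓ L := h1.trans_le (inf_le_inf_right _ hNM)
    exact h2.not_ge (hI.le_of_ge ⟨fun h => not_lt_bot (h ▸ h2), M, L, hM, hL, hML, rfl⟩ h2.le)
  exact hL ((key L₁ hL₁ hIL₁).symm.trans (key L₂ hL₂ hIL₂))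

theorem IsCoatom.map_conj {G : Type*} [Group G] {M : Subgroup G} (hM : IsCoatom M) (g : G) :
    IsCoatom (M.map (MulAut.conj g).toMonoidHom) :=
  ((MulAut.conj g).mapSubgroup.isCoatom_iff M).2 hM

section

open scoped Pointwise

/-- Distinct maximal subgroups intersect trivially and are self-normalizing: this is impossible in a
noncyclic finite group. -/
theorem isCyclic_of_isCoatom_inf_eq_bot {G : Type*} [Group G] [Finite G]
    (h : ∀ M₁ M₂ : Subgroup G, IsCoatom M₁ → IsCoatom M₂ → M₁ ≠ M₂ → M₁ ⊓ M₂ = ⊥)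
    (hn : ∀ M : Subgroup G, IsCoatom M → Subgroup.normalizer (M : Set G) = M)
    (hb : ¬ IsCoatom (⊥ : Subgroup G)) : IsCyclic G := by
  by_contra hcyc
  have hex : ∀ x : G, ∃ M : Subgroup G, IsCoatom M ∧ x ∈ M := by
    intro x
    have h1 : Subgroup.zpowers x ≠ ⊤ := fun h1 =>
      hcyc ⟨x, fun y => h1.ge (Subgroup.mem_top y)⟩
    obtain ⟨M, hM, hle⟩ := (eq_top_or_exists_le_coatom _).resolve_left h1
    exact ⟨M, hM, hle (Subgroup.mem_zpowers x)⟩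
  -- Parametrizes the nonidentity elements of the conjugates of `M`. Trivial intersections and
  -- self-normalization make it injective, so these number `|G| - |G : M|`, at least half of `|G|`.
  let φ : ∀ M : Subgroup G, (G ⧸ M) × {m : M // m ≠ 1} → {x : G // x ≠ 1} := fun M a =>
    ⟨a.1.out * a.2.1 * a.1.out⁻¹, by
      rw [Ne, conj_eq_one_iff]
      exact fun h => a.2.2 (Subtype.ext h)⟩
  have hφ : ∀ M (a), (φ M a : G) ∈ M.map (MulAut.conj a.1.out).toMonoidHom := fun M a =>
    ⟨a.2.1, a.2.1.2, rfl⟩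
  have heq : ∀ M₁ M₂, IsCoatom M₁ → IsCoatom M₂ → ∀ a b, φ M₁ a = φ M₂ b →
      M₁.map (MulAut.conj a.1.out).toMonoidHom = M₂.map (MulAut.conj b.1.out).toMonoidHom := by
    intro M₁ M₂ h₁ h₂ a b hab
    by_contra hne
    have h1 := h _ _ (h₁.map_conj _) (h₂.map_conj _) hne
    have h2 : (φ M₁ a : G) ∈ (⊥ : Subgroup G) := by
      rw [← h1]
      exact ⟨hφ M₁ a, hab ▸ hφ M₂ b⟩
    exact (φ M₁ a).2 (Subgroup.mem_bot.1 h2)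
  have hinj : ∀ M, IsCoatom M → Function.Injective (φ M) := by
    intro M hM a b hab
    have h1 := heq M M hM hM a b hab
    have h2 : a.1 = b.1 := by
      rw [← QuotientGroup.out_eq' a.1, ← QuotientGroup.out_eq' b.1, QuotientGroup.eq]
      have h3 : a.1.out⁻¹ * b.1.out ∈ Subgroup.normalizer (M : Set G) := by
        apply mem_normalizer_of_conj_smul_eq
        change MulAut.conj a.1.out • M = MulAut.conj b.1.out • M at h1
        rw [map_mul, mul_smul, ← h1, map_inv, inv_smul_smul]
      rwa [hn M hM] at h3
    obtain ⟨a1, a2⟩ := a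
    obtain ⟨b1, b2⟩ := b
    obtain rfl : a1 = b1 := h2
    have h3 : a1.out * (a2.1 : G) * a1.out⁻¹ = a1.out * (b2.1 : G) * a1.out⁻¹ :=
      congrArg Subtype.val hab
    rw [mul_left_inj, mul_right_inj] at h3
    exact Prod.ext rfl (Subtype.ext (Subtype.ext h3))
  have hone : ∀ (K : Type _) [Group K] [Finite K], Nat.card {m : K // m ≠ 1} + 1 = Nat.card K := by
    intro K _ _
    classical
    rw [← Finite.card_option, Nat.card_congr (Equiv.optionSubtypeNe (1 : K))]
  have hcard : ∀ M : Subgroup G, Nat.card ((G ⧸ M) × {m : M // m ≠ 1}) + M.index = Nat.card G := by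
    intro M
    rw [Nat.card_prod, ← M.index_eq_card, ← M.card_mul_index, ← hone M]
    ring
  have hge : ∀ M : Subgroup G, IsCoatom M → 2 * M.index ≤ Nat.card G ∧ 1 < M.index := by
    intro M hM
    have hMb : M ≠ ⊥ := fun h => hb (h ▸ hM)
    have h1 : 1 < Nat.card M :=
      Finite.one_lt_card_iff_nontrivial.2 ((Subgroup.nontrivial_iff_ne_bot M).2 hMb)
    have h2 : M.index ≠ 1 := fun h => hM.1 (Subgroup.index_eq_one.1 h)
    have h3 := M.index_ne_zero_of_finite
    refine ⟨?_, by omega⟩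
    rw [← M.card_mul_index]
    exact Nat.mul_le_mul_right _ h1
  obtain ⟨M₁, hM₁, -⟩ := hex 1
  -- One conjugacy class of maximal subgroups misses some `x ≠ 1`. A maximal `M₂` containing `x`
  -- gives a disjoint class, and the two together would need `|G|` nonidentity elements.
  have hns : ¬ Function.Surjective (φ M₁) := by
    intro hs
    have h1 := Nat.card_le_card_of_surjective _ hs
    have h2 := hcard M₁
    have h3 := hone G
    have h4 := (hge M₁ hM₁).2
    omega
  obtain ⟨x, hx⟩ : ∃ x, ∀ a, φ M₁ a ≠ x := by simpa [Function.Surjective] using hns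
  obtain ⟨M₂, hM₂, hxM⟩ := hex x
  have hdis : ∀ a b, φ M₁ a ≠ φ M₂ b := by
    intro a b hab
    have h1 := heq M₁ M₂ hM₁ hM₂ a b hab
    change MulAut.conj a.1.out • M₁ = MulAut.conj b.1.out • M₂ at h1
    set g := b.1.out⁻¹ * a.1.out with hg
    have h2 : (x : G) ∈ MulAut.conj g • M₁ := by
      rw [hg, map_mul, mul_smul, h1, map_inv, inv_smul_smul]
      exact hxM
    obtain ⟨m, hm, hmx⟩ := h2
    obtain ⟨k, hk⟩ : ∃ k ∈ M₁, g = (g : G ⧸ M₁).out * k :=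
      ⟨(g : G ⧸ M₁).out⁻¹ * g, by
        rw [← QuotientGroup.eq, QuotientGroup.out_eq'], by rw [mul_inv_cancel_left]⟩
    have hxm : (x : G) = g * m * g⁻¹ := hmx.symm
    refine hx ⟨(g : G ⧸ M₁), ⟨⟨k * m * k⁻¹, M₁.mul_mem (M₁.mul_mem hk.1 hm) (M₁.inv_mem hk.1)⟩,
      fun h => x.2 ?_⟩⟩ (Subtype.ext ?_)
    · have h3 : k * m * k⁻¹ = 1 := congrArg Subtype.val h
      rw [conj_eq_one_iff] at h3
      rw [hxm, h3, mul_one, mul_inv_cancel]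
    · change (g : G ⧸ M₁).out * (k * m * k⁻¹) * (g : G ⧸ M₁).out⁻¹ = x
      rw [hxm]
      conv_rhs => rw [hk.2]
      group
  have hsum := Nat.card_le_card_of_injective (Sum.elim (φ M₁) (φ M₂))
    (Function.Injective.sumElim (hinj _ hM₁) (hinj _ hM₂) hdis)
  rw [Nat.card_sum] at hsum
  have h1 := hcard M₁
  have h2 := hcard M₂
  have h3 := hone G
  have h4 := (hge M₁ hM₁).1
  have h5 := (hge M₂ hM₂).1
  omega

end

/-- A proper nontrivial normal subgroup is nilpotent, and its quotient inherits the hypothesis.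
Without one, counting the conjugates of maximal subgroups makes `G` cyclic. -/
theorem isSolvable_of_forall_isNilpotent (n : ℕ) : ∀ {G : Type u} [Group G] [Finite G],
    Nat.card G = n → (∀ H : Subgroup G, H ≠ ⊤ → Group.IsNilpotent H) → Group.IsSolvable G := by
  induction n using Nat.strong_induction_on with
  | _ n ih =>
    intro G _ _ hn hG
    by_cases hs : ∀ N : Subgroup G, N.Normal → N = ⊥ ∨ N = ⊤
    · have hbot : ∀ M : Subgroup G, IsCoatom M → M.Normal → IsCyclic G := by
        intro M hM hMn
        have hMb := (hs M hMn).resolve_right hM.1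
        obtain ⟨x, hx⟩ : ∃ x : G, x ∉ M := by
          by_contra! h
          exact hM.1 (eq_top_iff.2 fun x _ => h x)
        have h1 : Subgroup.zpowers x = ⊤ := (hMb ▸ hM).2 _ (bot_lt_iff_ne_bot.2 (by
          rw [Ne, Subgroup.zpowers_eq_bot]
          exact fun h => hx (h ▸ M.one_mem)))
        exact ⟨x, fun y => h1.ge (Subgroup.mem_top y)⟩
      suffices h : IsCyclic G from
        letI := h.commGroup
        inferInstance
      by_contra hcyc
      refine hcyc (isCyclic_of_isCoatom_inf_eq_bot
        (fun M₁ M₂ h₁ h₂ hne => isCoatom_inf_eq_bot hG hs h₁ h₂ hne) (fun M hM => ?_)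
        fun h => hcyc (hbot _ h inferInstance))
      by_contra hne
      refine hcyc (hbot M hM (Subgroup.normalizer_eq_top_iff.1 (hM.2 _ ?_)))
      exact lt_of_le_of_ne Subgroup.le_normalizer (Ne.symm hne)
    · push Not at hs
      obtain ⟨N, hN, hNb, hNt⟩ := hs
      refine (Group.isSolvable_iff_subgroup_quotient N).2 ⟨?_, ?_⟩
      · have := hG N hNt
        infer_instance
      · refine ih (Nat.card (G ⧸ N)) ?_ rfl fun H hH => ?_
        · rw [← hn, ← N.card_mul_index, ← N.index_eq_card]
          exact lt_mul_of_one_lt_left (Nat.pos_of_ne_zero N.index_ne_zero_of_finite)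
            (Finite.one_lt_card_iff_nontrivial.2 ((Subgroup.nontrivial_iff_ne_bot N).2 hNb))
        · have hs := QuotientGroup.mk'_surjective N
          have h1 : H.comap (QuotientGroup.mk' N) ≠ ⊤ := fun h => hH (by
            rw [← Subgroup.map_comap_eq_self_of_surjective hs H, h,
              Subgroup.map_top_of_surjective _ hs])
          have := hG _ h1
          exact Group.nilpotent_of_surjective _
            ((QuotientGroup.mk' N).subgroupComap_surjective_of_surjective H hs)

theorem exists_normal_prime_index {G : Type*} [Group G] [Finite G] [Nontrivial G]
    [Group.IsSolvable G] : ∃ C : Subgroup G, C.Normal ∧ C.index.Prime := by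
  have h1 := (Group.IsSolvable.commutator_lt_top_of_nontrivial G).ne
  obtain ⟨C, hC, hle⟩ := (eq_top_or_exists_le_coatom _).resolve_left h1
  have hCn : C.Normal := Subgroup.Normal.of_commutator_le _ hle
  have hsimple : IsSimpleGroup (G ⧸ C) := by
    have hs := QuotientGroup.mk'_surjective C
    have : Nontrivial (G ⧸ C) := QuotientGroup.nontrivial_iff.2 hC.1
    refine ⟨fun N _ => ?_⟩
    have h2 : C ≤ N.comap (QuotientGroup.mk' C) :=
      (QuotientGroup.ker_mk' C).ge.trans (Subgroup.ker_le_comap _ _)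
    rw [← Subgroup.map_comap_eq_self_of_surjective hs N]
    rcases h2.eq_or_lt with h | h
    · left; rw [← h, QuotientGroup.map_mk'_self]
    · right; rw [hC.2 _ h, Subgroup.map_top_of_surjective _ hs]
  refine ⟨C, hCn, ?_⟩
  let _ : CommGroup (G ⧸ C) := { mul_comm := IsSimpleGroup.comm_iff_isSolvable.2 inferInstance }
  rw [C.index_eq_card]
  exact IsSimpleGroup.prime_card

/-- **Schmidt's theorem** on the order of a minimal non-nilpotent group. -/
theorem IsSchmidtGroup.exists_isSchmidtPQGroup {G : Type*} [Group G] (hG : IsSchmidtGroup G) :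
    ∃ p q, IsSchmidtPQGroup p q G := by
  have := hG.1
  have hsol := isSolvable_of_forall_isNilpotent _ rfl hG.2.2
  have hnt : Nontrivial G := by
    by_contra h
    rw [not_nontrivial_iff_subsingleton] at h
    exact hG.2.1 inferInstance
  obtain ⟨C, hC, hq⟩ := exists_normal_prime_index (G := G)
  obtain ⟨q, hqC⟩ : ∃ q, q = C.index := ⟨_, rfl⟩
  rw [← hqC] at hq
  have := Fact.mk hq
  have hCtop : C ≠ ⊤ := fun h => hq.ne_one (by rw [hqC, h, Subgroup.index_top])
  have hCnil := hG.2.2 C hCtop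
  -- For `r ≠ q` a Sylow `r`-subgroup lies in the nilpotent normal subgroup `C` of index `q`, where
  -- it is characteristic.
  have hnorm : ∀ (r : ℕ) (_ : r.Prime) (_ : r ≠ q) (P : Sylow r G), (P : Subgroup G).Normal := by
    intro r hr hrq P
    have := Fact.mk hr
    have hPC : (P : Subgroup G) ≤ C := by
      intro x hx
      obtain ⟨n, hn⟩ := IsPGroup.iff_orderOf.1 P.2 ⟨x, hx⟩
      rw [Subgroup.orderOf_mk] at hn
      rw [← QuotientGroup.eq_one_iff, ← orderOf_eq_one_iff]
      have h1 : orderOf (x : G ⧸ C) ∣ r ^ n := hn ▸ orderOf_map_dvd (QuotientGroup.mk' C) x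
      have h2 : orderOf (x : G ⧸ C) ∣ q := by
        rw [hqC, C.index_eq_card]; exact orderOf_dvd_natCard _
      exact Nat.eq_one_of_dvd_coprimes
        (Nat.Coprime.pow_left n ((Nat.coprime_primes hr hq).2 hrq)) h1 h2
    have h1 := map_subtype_sylow_normal hr C (P.subtype hPC)
    rwa [Sylow.coe_subtype, Subgroup.subgroupOf_map_subtype, inf_eq_left.2 hPC] at h1
  obtain ⟨Q⟩ := (inferInstance : Nonempty (Sylow q G))
  by_cases hex : ∃ (r : ℕ) (_ : r.Prime) (_ : r ≠ q) (P : Sylow r G), (P : Subgroup G) ⊔ Q = ⊤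
  · obtain ⟨r, hr, hrq, P, hPQ⟩ := hex
    have hPn := hnorm r hr hrq P
    refine ⟨r, q, isSchmidtPQGroup_of_subset hr hq hG ?_ ⟨P, hPn⟩⟩
    refine Set.Subset.trans ?_ (groupPrimes_sup_subset hr hq P.2 Q.2)
    rw [hPQ]
    exact groupPrimes_subset_of_injective (f := (Subgroup.topEquiv (G := G)).symm.toMonoidHom)
      (Subgroup.topEquiv (G := G)).symm.injective
  -- Now every `P ⊔ Q` is proper, hence nilpotent, so each `P` centralizes `Q`. Thus `Q` is normal,
  -- all Sylow subgroups are normal, and `G` is nilpotent.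
  · push Not at hex
    exfalso
    have hQn : (Q : Subgroup G).Normal := by
      rw [← Subgroup.normalizer_eq_top_iff, ← Subgroup.index_eq_one]
      by_contra hne
      obtain ⟨r, hr, hrd⟩ := Nat.exists_prime_and_dvd hne
      by_cases hrq : r = q
      · subst hrq
        exact Q.not_dvd_index (hrd.trans (Subgroup.index_dvd_of_le Subgroup.le_normalizer))
      · have := Fact.mk hr
        obtain ⟨P⟩ := (inferInstance : Nonempty (Sylow r G))
        refine P.not_dvd_index (hrd.trans (Subgroup.index_dvd_of_le fun x hx => ?_))
        have hnil := hG.2.2 _ (hex r hr hrq P)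
        have hc : ∀ y ∈ Q, Commute x y := by
          intro y hy
          have h1 : Commute (⟨x, Subgroup.mem_sup_left hx⟩ : ↥((P : Subgroup G) ⊔ Q))
              ⟨y, Subgroup.mem_sup_right hy⟩ := by
            apply commute_of_coprime_orderOf
            rw [Subgroup.orderOf_mk, Subgroup.orderOf_mk]
            obtain ⟨n, hn⟩ := IsPGroup.iff_orderOf.1 P.2 ⟨x, hx⟩
            obtain ⟨m, hm⟩ := IsPGroup.iff_orderOf.1 Q.2 ⟨y, hy⟩
            rw [Subgroup.orderOf_mk] at hn hm
            rw [hn, hm]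
            exact Nat.Coprime.pow _ _ ((Nat.coprime_primes hr hq).2 hrq)
          exact congrArg Subtype.val h1
        exact Subgroup.centralizer_le_normalizer _
          (Subgroup.mem_centralizer_iff.2 fun y hy => (hc y hy).eq.symm)
    refine hG.2.1 (isNilpotent_of_sylow_normal fun r hr P => ?_)
    by_cases hrq : r = q
    · subst hrq
      have := Sylow.unique_of_normal Q hQn
      rwa [Subsingleton.elim P Q]
    · exact hnorm r hr.out hrq P

/-! ### The Frattini quotient of a Schmidt group -/

/-- `E` is a semidirect product of a faithful irreducible `𝔽_p`-module and a group of order `q`. -/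
def IsPrimitiveExtension (p q : ℕ) (E : Type*) [Group E] : Prop :=
  ∃ (V : Subgroup E) (y : E), Minimal (fun V : Subgroup E => V.Normal ∧ V ≠ ⊥) V ∧
    IsMulCommutative V ∧ (∀ v ∈ V, v ^ p = 1) ∧ y ^ q = 1 ∧ V ⊔ Subgroup.zpowers y = ⊤ ∧
    ∃ v ∈ V, ¬ Commute v y

theorem pow_eq_one_of_minimal_normal {p : ℕ} (hp : p.Prime) {E : Type*} [Group E] [Finite E]
    {V : Subgroup E} [IsMulCommutative V]
    (hV : Minimal (fun V : Subgroup E => V.Normal ∧ V ≠ ⊥) V) (hpV : p ∣ Nat.card V) :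
    ∀ v ∈ V, v ^ p = 1 := by
  have := Fact.mk hp
  have hVn := hV.prop.1
  have hc : ∀ a ∈ V, ∀ b ∈ V, Commute a b := fun a ha b hb =>
    congrArg Subtype.val (mul_comm' (⟨a, ha⟩ : V) ⟨b, hb⟩)
  let W : Subgroup E :=
    { carrier := {v | v ∈ V ∧ v ^ p = 1}
      mul_mem' := fun {a b} ha hb => ⟨V.mul_mem ha.1 hb.1, by
        rw [(hc a ha.1 b hb.1).mul_pow, ha.2, hb.2, one_mul]⟩
      one_mem' := ⟨V.one_mem, one_pow p⟩
      inv_mem' := fun {a} ha => ⟨V.inv_mem ha.1, by rw [inv_pow, ha.2, inv_one]⟩ }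
  have hWn : W.Normal := ⟨fun v hv g => ⟨hVn.conj_mem v hv.1 g, by
    rw [conj_pow, hv.2, mul_one, mul_inv_cancel]⟩⟩
  have hWb : W ≠ ⊥ := by
    obtain ⟨v, hv⟩ := exists_prime_orderOf_dvd_card' p hpV
    intro h
    have h1 : (v : E) ∈ W := ⟨v.2, by
      have := pow_orderOf_eq_one v
      rw [hv] at this
      exact congrArg Subtype.val this⟩
    rw [h, Subgroup.mem_bot] at h1
    have h2 : v = 1 := Subtype.ext h1
    rw [h2, orderOf_one] at hv
    exact hp.ne_one hv.symm
  exact fun v hv => (hV.le_of_le ⟨hWn, hWb⟩ (fun w hw => hw.1) hv).2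

theorem commutator_mem_of_commute_mk {G : Type*} [Group G] {N : Subgroup G} [N.Normal] {x y : G}
    (h : Commute (x : G ⧸ N) (y : G ⧸ N)) : x * y * x⁻¹ * y⁻¹ ∈ N := by
  rw [← QuotientGroup.eq_one_iff]
  change (x : G ⧸ N) * (y : G ⧸ N) * (x : G ⧸ N)⁻¹ * (y : G ⧸ N)⁻¹ = 1
  rw [h.eq, mul_inv_cancel_right, mul_inv_cancel]

/-- With `z` the commutator, `x y x⁻¹ = z y`; raising this to the order of `y` gives `z ^ orderOf y
= 1`. -/
theorem commute_of_commute_commutator {G : Type*} [Group G] [Finite G] {x y : G}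
    (h : Commute (x * y * x⁻¹ * y⁻¹) y) (hc : (orderOf (x * y * x⁻¹ * y⁻¹)).Coprime (orderOf y)) :
    Commute x y := by
  set z := x * y * x⁻¹ * y⁻¹ with hz
  have h1 : z * y = x * y * x⁻¹ := by rw [hz, inv_mul_cancel_right]
  have h2 : z ^ orderOf y = 1 := by
    have h3 := h.mul_pow (orderOf y)
    rwa [h1, conj_pow, pow_orderOf_eq_one, mul_one, mul_one, mul_inv_cancel, eq_comm] at h3
  have h4 : z = 1 := orderOf_eq_one_iff.1
    (Nat.eq_one_of_dvd_coprimes hc dvd_rfl (orderOf_dvd_of_pow_eq_one h2))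
  rw [h4, one_mul] at h1
  exact eq_mul_inv_iff_mul_eq.1 h1 |>.symm

/-- Here `S = P⟨y⟩`, and `N = N₀⟨y ^ q⟩` with `N₀` maximal among the normal subgroups of `S`
properly inside `P`. -/
theorem IsSchmidtPQGroup.exists_quotient_isPrimitiveExtension {p q : ℕ} {S : Type*} [Group S]
    (hS : IsSchmidtPQGroup p q S) :
    ∃ (N : Subgroup S) (_ : N.Normal), N ≤ frattini S ∧ IsPrimitiveExtension p q (S ⧸ N) := by
  have := hS.finite
  have hp := hS.prime_left
  have hq := hS.prime_right
  have hpq := hS.ne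
  have := Fact.mk hp
  have := Fact.mk hq
  have hsol := hS.isSolvable
  obtain ⟨P, hP⟩ := hS.2.2
  obtain ⟨Q⟩ := (inferInstance : Nonempty (Sylow q S))
  obtain ⟨x, hx, y, hy, hxy⟩ : ∃ x ∈ P, ∃ y ∈ Q, ¬ Commute x y := by
    by_contra! h
    exact hS.not_isNilpotent (isNilpotent_of_sylow_commute hp hq hpq hS.2.1.le P Q h)
  have hordP : ∀ u ∈ P, ∃ n, orderOf u = p ^ n := fun u hu => by
    simpa using IsPGroup.iff_orderOf.1 P.2 ⟨u, hu⟩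
  have hordQ : ∀ v ∈ Q, ∃ n, orderOf v = q ^ n := fun v hv => by
    simpa using IsPGroup.iff_orderOf.1 Q.2 ⟨v, hv⟩
  have hcop : ∀ u ∈ P, ∀ v ∈ Q, (orderOf u).Coprime (orderOf v) := by
    intro u hu v hv
    obtain ⟨n, hn⟩ := hordP u hu
    obtain ⟨m, hm⟩ := hordQ v hv
    rw [hn, hm]
    exact Nat.Coprime.pow _ _ ((Nat.coprime_primes hp hq).2 hpq)
  have hPQ : ∀ u ∈ P, u ∈ Q → u = 1 := fun u hu hu' =>
    orderOf_eq_one_iff.1 ((Nat.coprime_self _).1 (hcop u hu u hu'))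
  have hcomm : ∀ W : Subgroup S, W ≤ P → ∀ v ∈ Q, W ⊔ Subgroup.zpowers v ≠ ⊤ →
      ∀ w ∈ W, Commute w v := by
    intro W hWP v hv hne w hw
    have := hS.1.2.2 _ hne
    have h1 : Commute (⟨w, Subgroup.mem_sup_left hw⟩ : ↥(W ⊔ Subgroup.zpowers v))
        ⟨v, Subgroup.mem_sup_right (Subgroup.mem_zpowers v)⟩ := by
      apply commute_of_coprime_orderOf
      rw [Subgroup.orderOf_mk, Subgroup.orderOf_mk]
      exact hcop w (hWP hw) v hv
    exact congrArg Subtype.val h1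
  have htop : (P : Subgroup S) ⊔ Subgroup.zpowers y = ⊤ := by
    by_contra h
    exact hxy (hcomm P le_rfl y hy h x hx)
  -- Modulo `P`, `y` has order a nontrivial power of `q`, so `y ^ q` has smaller order. The proper
  -- subgroup `P⟨y ^ q⟩` is nilpotent, which makes `y ^ q` central.
  have htop' : (P : Subgroup S) ⊔ Subgroup.zpowers (y ^ q) ≠ ⊤ := by
    intro h
    have h1 : ∀ v : S, (P : Subgroup S) ⊔ Subgroup.zpowers v = ⊤ →
        orderOf (v : S ⧸ (P : Subgroup S)) = Nat.card (S ⧸ (P : Subgroup S)) := by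
      intro v hv
      have h2 := congrArg (Subgroup.map (QuotientGroup.mk' (P : Subgroup S))) hv
      rw [Subgroup.map_sup, QuotientGroup.map_mk'_self, bot_sup_eq, MonoidHom.map_zpowers,
        Subgroup.map_top_of_surjective _ (QuotientGroup.mk'_surjective _)] at h2
      rw [← Nat.card_zpowers]
      change Nat.card (Subgroup.zpowers ((QuotientGroup.mk' (P : Subgroup S)) v)) = _
      rw [h2, Subgroup.card_top]
    have h2 := (h1 _ h).trans (h1 _ htop).symm
    obtain ⟨n, hn⟩ := hordQ y hy
    have h3 : orderOf (y : S ⧸ (P : Subgroup S)) ∣ q ^ n :=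
      hn ▸ orderOf_map_dvd (QuotientGroup.mk' (P : Subgroup S)) y
    obtain ⟨m, -, hm⟩ := (Nat.dvd_prime_pow hq).1 h3
    rcases m with _ | m
    · rw [pow_zero, orderOf_eq_one_iff, QuotientGroup.eq_one_iff] at hm
      exact hxy (hPQ y hm hy ▸ Commute.one_right x)
    · rw [QuotientGroup.mk_pow, orderOf_pow, hm, pow_succ, Nat.gcd_mul_left_left,
        Nat.mul_div_cancel _ hq.pos] at h2
      have h4 := hq.one_lt
      have h5 : 0 < q ^ m := pow_pos hq.pos m
      nlinarith
  have hcen : y ^ q ∈ Subgroup.center S := by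
    rw [Subgroup.mem_center_iff]
    have h1 : (⊤ : Subgroup S) ≤ Subgroup.centralizer {y ^ q} := by
      rw [← htop, sup_le_iff, Subgroup.zpowers_le]
      constructor
      · intro u hu
        rw [Subgroup.mem_centralizer_singleton_iff]
        exact (hcomm P le_rfl _ (Q.pow_mem hy q) htop' u hu).eq
      · rw [Subgroup.mem_centralizer_singleton_iff]
        exact ((Commute.refl y).pow_right q).eq
    intro g
    exact Subgroup.mem_centralizer_singleton_iff.1 (h1 (Subgroup.mem_top g))
  have hW : ∀ W : Subgroup S, W.Normal → W ≤ P → W ≠ P → ∀ w ∈ W, Commute w y := by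
    intro W hWn hWP hne
    refine hcomm W hWP y hy fun h => hne (le_antisymm hWP fun u hu => ?_)
    obtain ⟨w, hw, z, hz, rfl⟩ := Subgroup.mem_sup_of_normal_left.1 (h.ge (Subgroup.mem_top u))
    have hzP : z ∈ P := by
      have := P.mul_mem (P.inv_mem (hWP hw)) hu
      rwa [inv_mul_cancel_left] at this
    rw [hPQ z hzP ((Subgroup.zpowers_le (H := (Q : Subgroup S))).2 hy hz), mul_one]
    exact hw
  have hWy : ∀ u ∈ P, Commute (u * y * u⁻¹ * y⁻¹) y → Commute u y := by
    intro u hu h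
    refine commute_of_commute_commutator h (hcop _ ?_ y hy)
    rw [mul_assoc, mul_assoc, ← mul_assoc y]
    exact P.mul_mem hu (hP.conj_mem _ (P.inv_mem hu) y)
  obtain ⟨N₀, hN₀⟩ := Set.Finite.exists_maximal
    (Set.toFinite {W : Subgroup S | W.Normal ∧ W ≤ P ∧ W ≠ P})
    ⟨⊥, inferInstance, bot_le, fun h => hxy (by
      have h1 : x ∈ (⊥ : Subgroup S) := h ▸ hx
      rw [Subgroup.mem_bot.1 h1]
      exact Commute.one_left y)⟩
  obtain ⟨hN₀n, hN₀P, hN₀ne⟩ := hN₀.prop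
  have hquot : ¬ Group.IsNilpotent (S ⧸ N₀) := by
    intro hnil
    refine hxy (hWy x hx (hW N₀ hN₀n hN₀P hN₀ne _ ?_))
    have h1 : Commute (x : S ⧸ N₀) (y : S ⧸ N₀) := by
      apply commute_of_coprime_orderOf
      exact Nat.Coprime.of_dvd (orderOf_map_dvd (QuotientGroup.mk' N₀) x)
        (orderOf_map_dvd (QuotientGroup.mk' N₀) y) (hcop x hx y hy)
    exact commutator_mem_of_commute_mk h1
  -- If a maximal `M` misses `W`, then `S ⧸ W` is an image of the nilpotent group `M`. Neither `S ⧸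
  -- N₀` nor `S ⧸ ⟨y ^ q⟩` is nilpotent, so both kernels lie in `Φ(S)`.
  have hcoatom : ∀ (M W : Subgroup S) [W.Normal], IsCoatom M → ¬ W ≤ M →
      Group.IsNilpotent (S ⧸ W) := by
    intro M W _ hM hWM
    have h1 : M ⊔ W = ⊤ := hM.2 _ (left_lt_sup.2 hWM)
    have := hS.1.2.2 M hM.1
    refine Group.nilpotent_of_surjective ((QuotientGroup.mk' W).comp M.subtype) ?_
    rw [← MonoidHom.range_eq_top, MonoidHom.range_comp, Subgroup.range_subtype,
      ← Subgroup.map_top_of_surjective _ (QuotientGroup.mk'_surjective W), ← h1,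
      Subgroup.map_sup, QuotientGroup.map_mk'_self, sup_bot_eq]
  have hZ : (Subgroup.zpowers (y ^ q)) ≤ Subgroup.center S := by
    rwa [Subgroup.zpowers_le]
  have hZn : (Subgroup.zpowers (y ^ q)).Normal := ⟨fun z hz g => by
    rwa [Subgroup.mem_center_iff.1 (hZ hz) g, mul_inv_cancel_right]⟩
  have hN : N₀ ⊔ Subgroup.zpowers (y ^ q) ≤ frattini S := by
    refine sup_le (le_iInf₂ fun M hM => ?_) (le_iInf₂ fun M hM => ?_)
    · by_contra h
      exact hquot (hcoatom M N₀ hM h)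
    · by_contra h
      have := hcoatom M _ hM h
      exact hS.not_isNilpotent (Subgroup.isNilpotent_of_ker_le_center
        (QuotientGroup.mk' (Subgroup.zpowers (y ^ q))) (by rwa [QuotientGroup.ker_mk']))
  set N := N₀ ⊔ Subgroup.zpowers (y ^ q) with hNdef
  have hNy : ∀ n ∈ N, Commute n y := by
    intro n hn
    have h1 : N ≤ Subgroup.centralizer {y} := by
      refine sup_le (fun w hw => ?_) fun z hz => ?_
      · exact Subgroup.mem_centralizer_singleton_iff.2 (hW N₀ hN₀n hN₀P hN₀ne w hw).eq
      · exact Subgroup.mem_centralizer_singleton_iff.2 (Subgroup.mem_center_iff.1 (hZ hz) y).symm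
    exact Subgroup.mem_centralizer_singleton_iff.1 (h1 hn)
  have hs := QuotientGroup.mk'_surjective N
  have hnc : ¬ Commute (x : S ⧸ N) (y : S ⧸ N) := by
    intro h1
    refine hxy (hWy x hx (hNy _ ?_))
    exact commutator_mem_of_commute_mk h1
  have hVb : (P : Subgroup S).map (QuotientGroup.mk' N) ≠ ⊥ := by
    intro h
    have h1 : (x : S ⧸ N) ∈ (⊥ : Subgroup (S ⧸ N)) := h ▸ Subgroup.mem_map_of_mem _ hx
    exact hnc (Subgroup.mem_bot.1 h1 ▸ Commute.one_left _)
  have hV : Minimal (fun V : Subgroup (S ⧸ N) => V.Normal ∧ V ≠ ⊥)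
      ((P : Subgroup S).map (QuotientGroup.mk' N)) := by
    refine ⟨⟨hP.map _ hs, hVb⟩, fun W hWn hWV => ?_⟩
    have hWn' := hWn.1
    by_cases h : W.comap (QuotientGroup.mk' N) ⊓ P = P
    · rw [Subgroup.map_le_iff_le_comap]
      exact inf_eq_right.1 h
    · refine absurd (eq_bot_iff.2 fun w hw => ?_) hWn.2
      obtain ⟨u, hu, rfl⟩ := hWV hw
      have h1 : N₀ ≤ W.comap (QuotientGroup.mk' N) ⊓ P := by
        refine le_inf ((le_sup_left : N₀ ≤ N).trans ?_) hN₀P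
        exact (QuotientGroup.ker_mk' N).ge.trans (Subgroup.ker_le_comap _ _)
      have h2 := hN₀.le_of_ge ⟨inferInstance, inf_le_right, h⟩ h1
      have h3 : u ∈ N := Subgroup.mem_sup_left (h2 ⟨hw, hu⟩)
      exact Subgroup.mem_bot.2 ((QuotientGroup.eq_one_iff u).2 h3)
  have hVc := isMulCommutative_of_minimal_normal hV
  refine ⟨N, inferInstance, hN, _, (y : S ⧸ N), hV, hVc,
    pow_eq_one_of_minimal_normal hp hV ?_, ?_, ?_, x, Subgroup.mem_map_of_mem _ hx, hnc⟩
  · have h1 : IsPGroup p ((P : Subgroup S).map (QuotientGroup.mk' N)) := P.2.map _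
    refine h1.card_eq_or_dvd.resolve_left fun h => hVb (Subgroup.card_eq_one.1 h)
  · rw [← QuotientGroup.mk_pow, QuotientGroup.eq_one_iff]
    exact Subgroup.mem_sup_right (Subgroup.mem_zpowers _)
  · have h1 := congrArg (Subgroup.map (QuotientGroup.mk' N)) htop
    rwa [Subgroup.map_sup, MonoidHom.map_zpowers, Subgroup.map_top_of_surjective _ hs] at h1

/-! ### Irreducible linear operators of prime order -/

section

open Polynomial

variable {k A A' : Type*} [Field k] [AddCommGroup A] [Module k A] [AddCommGroup A'] [Module k A']

/-- A linear operator on a nonzero space without proper nonzero invariant subspaces. -/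
def IsIrreducibleOperator (T : A →ₗ[k] A) : Prop :=
  Nontrivial A ∧ ∀ W : Submodule k A, W ≤ W.comap T → W = ⊥ ∨ W = ⊤

/-- The `T`-invariant subspaces are exactly the `k[X]`-submodules. -/
theorem IsIrreducibleOperator.isSimpleModule {T : A →ₗ[k] A} (hT : IsIrreducibleOperator T) :
    IsSimpleModule k[X] (Module.AEval' T) := by
  have := hT.1
  have hnt : Nontrivial (Module.AEval' T) := (Module.AEval'.of T).symm.toEquiv.nontrivial
  rw [isSimpleModule_iff]
  refine ⟨fun W => ?_⟩
  set e := Module.AEval.mapSubmodule k A T with he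
  rcases hT.2 (e.symm W).1 (e.symm W).2 with h | h
  · left
    rw [eq_bot_iff]
    intro m hm
    have h1 : (Module.AEval'.of T).symm m ∈ (e.symm W).1 := by
      rw [Module.AEval.mem_mapSubmodule_symm_apply]
      simpa using hm
    rw [h, Submodule.mem_bot] at h1
    simpa using h1
  · right
    rw [eq_top_iff]
    intro m _
    have h1 : (Module.AEval'.of T).symm m ∈ (e.symm W).1 := h ▸ Submodule.mem_top
    rw [Module.AEval.mem_mapSubmodule_symm_apply] at h1
    simpa using h1

theorem IsIrreducibleOperator.exists_ideal {T : A →ₗ[k] A} (hT : IsIrreducibleOperator T) :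
    ∃ I : Ideal k[X], I.IsMaximal ∧ Nonempty (Module.AEval' T ≃ₗ[k[X]] k[X] ⧸ I) ∧
      ∀ f, f ∈ I ↔ aeval T f = 0 := by
  obtain ⟨I, hI, ⟨e⟩⟩ := isSimpleModule_iff_quot_maximal.1 hT.isSimpleModule
  refine ⟨I, hI, ⟨e⟩, fun f => ?_⟩
  have h1 := e.annihilator_eq
  rw [Ideal.annihilator_quotient] at h1
  rw [← h1]
  have h2 := Module.AEval.annihilator_eq_ker_aeval (R := k) (M := A) (a := T)
  change f ∈ Module.annihilator k[X] (Module.AEval k A T) ↔ _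
  rw [h2, RingHom.mem_ker]

/-- In the field `k[X] ⧸ I` the class `ζ` of `X` is a primitive `q`-th root of unity. The generator
of `I'` divides `X ^ q - 1`, so it has a root `ζ ^ i`; if `q` divided `i`, this root would be `1`
and `I'` would contain `X - 1`. -/
theorem exists_aeval_pow_eq_zero {q : ℕ} (hq : q.Prime) {I I' : Ideal k[X]} (hI : I.IsMaximal)
    (hI' : I'.IsMaximal) (h : X ^ q - 1 ∈ I) (h' : X ^ q - 1 ∈ I') (h1 : X - 1 ∉ I)
    (h1' : X - 1 ∉ I') :
    ∃ i : ℕ, i.Coprime q ∧ ∀ f ∈ I', f.comp (X ^ i) ∈ I := by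
  obtain ⟨f, rfl⟩ : ∃ f, I' = Ideal.span {f} := ⟨_, (Ideal.span_singleton_generator I').symm⟩
  let _ := Ideal.Quotient.field I
  let φ := Ideal.Quotient.mk I
  let ψ : k →+* k[X] ⧸ I := φ.comp C
  have hφ : ∀ (g : k[X]) (i : ℕ), φ (g.comp (X ^ i)) = g.eval₂ ψ (φ X ^ i) := by
    intro g i
    rw [comp, hom_eval₂, map_pow]
  have hζ1 : φ X ≠ 1 := fun h2 => h1 (Ideal.Quotient.eq_zero_iff_mem.1
    (by rw [map_sub, map_one]; exact sub_eq_zero.2 h2))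
  have hζq : φ X ^ q = 1 := by
    have h2 := Ideal.Quotient.eq_zero_iff_mem.2 h
    rw [map_sub, map_pow, map_one] at h2
    exact sub_eq_zero.1 h2
  have hprim : IsPrimitiveRoot (φ X) q := by
    have h2 : orderOf (φ X) = q := by
      have := Fact.mk hq
      exact orderOf_eq_prime hζq hζ1
    exact h2 ▸ IsPrimitiveRoot.orderOf (φ X)
  have hf : f ∣ X ^ q - 1 := Ideal.mem_span_singleton.1 h'
  have hg0 : (X ^ q - 1 : (k[X] ⧸ I)[X]) ≠ 0 := by
    simpa using X_pow_sub_C_ne_zero hq.pos (1 : k[X] ⧸ I)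
  have hfψ : f.map ψ ∣ X ^ q - 1 := by
    simpa using Polynomial.map_dvd ψ hf
  have hs : Splits (X ^ q - 1 : (k[X] ⧸ I)[X]) := by
    rw [X_pow_sub_one_eq_prod hq.pos hprim]
    exact Splits.prod fun ζ _ => Splits.X_sub_C ζ
  have hdeg : (f.map ψ).degree ≠ 0 := by
    rw [degree_map]
    intro h2
    exact hI'.ne_top (Ideal.span_singleton_eq_top.2 (isUnit_iff_degree_eq_zero.2 h2))
  obtain ⟨r, hr⟩ := (hs.of_dvd hg0 hfψ).exists_eval_eq_zero hdeg
  have hrq : r ^ q = 1 := by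
    obtain ⟨g, hg⟩ := hfψ
    have h2 := congrArg (eval r) hg
    rw [eval_mul, hr, zero_mul, eval_sub, eval_pow, eval_X, eval_one] at h2
    exact sub_eq_zero.1 h2
  have := NeZero.mk hq.ne_zero
  obtain ⟨i, -, rfl⟩ := hprim.eq_pow_of_pow_eq_one hrq
  rw [eval_map] at hr
  refine ⟨i, ?_, fun g hg => ?_⟩
  · rw [Nat.coprime_comm, hq.coprime_iff_not_dvd]
    rintro ⟨j, rfl⟩
    rw [pow_mul, hζq, one_pow] at hr
    have h2 : f.eval 1 = 0 := by
      rw [← map_one ψ, eval₂_hom] at hr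
      exact (map_eq_zero_iff ψ ψ.injective).1 hr
    have h3 : X - 1 ∣ f := by simpa using dvd_iff_isRoot.2 h2
    have h4 : Ideal.span {f} ≤ Ideal.span {X - 1} := Ideal.span_singleton_le_span_singleton.2 h3
    have h5 : Ideal.span {X - (1 : k[X])} ≠ ⊤ := by
      rw [Ne, Ideal.span_singleton_eq_top]
      exact not_isUnit_X_sub_C (1 : k)
    exact h1' ((hI'.eq_of_le h5 h4).ge (Ideal.mem_span_singleton_self _))
  · obtain ⟨c, rfl⟩ := Ideal.mem_span_singleton.1 hg
    rw [← Ideal.Quotient.eq_zero_iff_mem]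
    change φ _ = 0
    rw [hφ, eval₂_mul, hr, zero_mul]

/-- Two irreducible operators of the same prime order are conjugate up to replacing one of them by
a power. -/
theorem IsIrreducibleOperator.exists_linearEquiv {q : ℕ} (hq : q.Prime) {T : A →ₗ[k] A}
    {T' : A' →ₗ[k] A'} (hT : IsIrreducibleOperator T) (hT' : IsIrreducibleOperator T')
    (hTq : T ^ q = 1) (hTq' : T' ^ q = 1) (hT1 : T ≠ 1) (hT1' : T' ≠ 1) :
    ∃ i : ℕ, i.Coprime q ∧ ∃ φ : A ≃ₗ[k] A', ∀ a, φ ((T ^ i) a) = T' (φ a) := by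
  obtain ⟨I, hI, -, hIT⟩ := hT.exists_ideal
  obtain ⟨I', hI', ⟨e'⟩, hIT'⟩ := hT'.exists_ideal
  obtain ⟨i, hi, hcomp⟩ := exists_aeval_pow_eq_zero hq hI hI' (by simp [hIT, hTq])
    (by simp [hIT', hTq']) (by simpa [hIT, sub_eq_zero] using hT1)
    (by simpa [hIT', sub_eq_zero] using hT1')
  refine ⟨i, hi, ?_⟩
  have hTi : IsIrreducibleOperator (T ^ i) := by
    refine ⟨hT.1, fun W hW => hT.2 W ?_⟩
    -- `T` is itself a power of `T ^ i`, so both have the same invariant subspaces.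
    obtain ⟨j, hj⟩ : ∃ j, (T ^ i) ^ j = T := by
      obtain ⟨j, -, hj⟩ := Nat.exists_mul_mod_eq_one_of_coprime hi hq.one_lt
      refine ⟨j, ?_⟩
      rw [← pow_mul, pow_eq_pow_mod _ hTq, hj, pow_one]
    have h1 : ∀ (j : ℕ), ∀ w ∈ W, ((T ^ i) ^ j) w ∈ W := by
      intro j
      induction j with
      | zero => exact fun w hw => hw
      | succ j ih =>
        intro w hw
        rw [pow_succ]
        exact ih _ (hW hw)
    intro w hw
    have := h1 j w hw
    rwa [hj] at this
  obtain ⟨J, hJ, ⟨e⟩, hJT⟩ := hTi.exists_ideal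
  -- Every `f ∈ I'` kills `T ^ i`, so `I' ≤ J`, and maximality gives equality: both modules are
  -- `k[X] ⧸ I'`.
  have hJI : I' = J := by
    refine hI'.eq_of_le hJ.ne_top fun f hf => ?_
    have h1 := (hIT _).1 (hcomp f hf)
    rw [aeval_comp] at h1
    rw [hJT]
    simpa using h1
  subst hJI
  let ψ : Module.AEval' (T ^ i) ≃ₗ[k[X]] Module.AEval' T' := e.trans e'.symm
  refine ⟨((Module.AEval'.of (T ^ i)).trans (ψ.restrictScalars k)).trans
    (Module.AEval'.of T').symm, fun a => ?_⟩
  have h1 : ψ (Module.AEval'.of (T ^ i) ((T ^ i) a)) =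
      Module.AEval'.of T' (T' ((Module.AEval'.of T').symm (ψ (Module.AEval'.of (T ^ i) a)))) := by
    rw [← Module.AEval'.X_smul_of, map_smul, ← Module.AEval'.X_smul_of,
      LinearEquiv.apply_symm_apply]
  change (Module.AEval'.of T').symm (ψ (Module.AEval'.of (T ^ i) ((T ^ i) a))) = _
  rw [h1, LinearEquiv.symm_apply_apply]
  rfl

end

/-! ### Uniqueness of primitive extensions -/

section

open scoped IsMulCommutative

/-- Conjugation by `y` on a commutative normal subgroup of exponent `p`, as a linear operator. -/
noncomputable def conjLinearMap {E : Type*} [Group E] (p : ℕ) (V : Subgroup E) [V.Normal]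
    [IsMulCommutative V] [Module (ZMod p) (Additive V)] (y : E) :
    Additive V →ₗ[ZMod p] Additive V :=
  (MonoidHom.toAdditive (MulAut.conjNormal (H := V) y).toMonoidHom).toZModLinearMap p

theorem conjLinearMap_pow_apply {E : Type*} [Group E] (p : ℕ) (V : Subgroup E) [V.Normal]
    [IsMulCommutative V] [Module (ZMod p) (Additive V)] (y : E) (n : ℕ) (v : Additive V) :
    (conjLinearMap p V y ^ n) v =
      Additive.ofMul (MulAut.conjNormal (H := V) (y ^ n) (Additive.toMul v)) := by
  induction n generalizing v with
  | zero => simp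
  | succ n ih =>
    rw [pow_succ, Module.End.mul_apply, ih, pow_succ, map_mul]
    rfl

/-- An invariant subspace is a subgroup normalized by the abelian `V` and by `y`, hence normal in
`E`; minimality of `V` applies. -/
theorem isIrreducibleOperator_conjLinearMap {E : Type*} [Group E] {p : ℕ} [Fact p.Prime]
    {V : Subgroup E} [V.Normal] [IsMulCommutative V] [Module (ZMod p) (Additive V)] {y : E}
    (hV : Minimal (fun V : Subgroup E => V.Normal ∧ V ≠ ⊥) V) [Finite E]
    (hy : V ⊔ Subgroup.zpowers y = ⊤) : IsIrreducibleOperator (conjLinearMap p V y) := by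
  refine ⟨?_, fun W hW => or_iff_not_imp_left.2 fun hb => ?_⟩
  · have := (Subgroup.nontrivial_iff_ne_bot V).2 hV.prop.2
    infer_instance
  let W' : Subgroup V := W.toAddSubgroup.toSubgroup'
  have hmem : ∀ v : V, v ∈ W' ↔ Additive.ofMul v ∈ W := fun v => Iff.rfl
  let U : Subgroup E := W'.map V.subtype
  have hUV : U ≤ V := Subgroup.map_subtype_le _
  have hUb : U ≠ ⊥ := by
    obtain ⟨w, hw, hw0⟩ := Submodule.exists_mem_ne_zero_of_ne_bot hb
    intro h
    have h1 : ((Additive.toMul w : V) : E) ∈ U :=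
      Subgroup.mem_map_of_mem V.subtype ((hmem (Additive.toMul w)).2 hw)
    rw [h, Subgroup.mem_bot] at h1
    exact hw0 (Additive.toMul.injective (Subtype.ext h1))
  have hUn : U.Normal := by
    rw [← Subgroup.normalizer_eq_top_iff, eq_top_iff, ← hy, sup_le_iff, Subgroup.zpowers_le]
    constructor
    · intro v hv
      refine Subgroup.centralizer_le_normalizer _ (Subgroup.mem_centralizer_iff.2 fun u hu => ?_)
      exact congrArg Subtype.val (mul_comm' (⟨u, hUV hu⟩ : V) ⟨v, hv⟩)
    · have h1 : ∀ u ∈ U, y * u * y⁻¹ ∈ U := by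
        rintro _ ⟨w, hw, rfl⟩
        exact ⟨MulAut.conjNormal (H := V) y w, hW ((hmem w).1 hw), by simp⟩
      open scoped Pointwise in
      apply mem_normalizer_of_conj_smul_eq
      open scoped Pointwise in
      refine Subgroup.eq_of_le_of_card_ge (fun u hu => ?_)
        (Nat.card_congr (Subgroup.equivSMul (MulAut.conj y) U).toEquiv).le
      obtain ⟨u, hu, rfl⟩ := hu
      exact h1 u hu
  have hUeq := hV.le_of_le ⟨hUn, hUb⟩ hUV
  rw [eq_top_iff]
  intro v _
  obtain ⟨w, hw, hwv⟩ := hUeq (Additive.toMul v).2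
  have h2 : w = Additive.toMul v := Subtype.ext hwv
  have h3 := (hmem w).1 hw
  rwa [h2] at h3

theorem isComplement'_zpowers {E : Type*} [Group E] [Finite E] {q : ℕ} (hq : q.Prime)
    {V : Subgroup E} [V.Normal] [IsMulCommutative V] {z : E} (hz : z ^ q = 1)
    (htop : V ⊔ Subgroup.zpowers z = ⊤) (hn : ∃ v ∈ V, ¬ Commute v z) :
    V.IsComplement' (Subgroup.zpowers z) ∧ orderOf z = q := by
  obtain ⟨v, hv, hvz⟩ := hn
  have := Fact.mk hq
  have hord : orderOf z = q := orderOf_eq_prime hz fun h => hvz (h ▸ Commute.one_right v)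
  refine ⟨Subgroup.isComplement'_of_disjoint_and_mul_eq_univ ?_ ?_, hord⟩
  · have h1 : Nat.card (Subgroup.zpowers z) = q := by rw [Nat.card_zpowers, hord]
    have h2 : IsPGroup q (Subgroup.zpowers z) := IsPGroup.of_card (n := 1) (by rw [h1, pow_one])
    rw [disjoint_iff]
    by_contra hne
    have h3 : Nat.card ↥(V ⊓ Subgroup.zpowers z) ∣ q :=
      h1 ▸ Subgroup.card_dvd_of_le inf_le_right
    have h4 : V ⊓ Subgroup.zpowers z = Subgroup.zpowers z := by
      refine Subgroup.eq_of_le_of_card_ge inf_le_right ?_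
      rcases (Nat.dvd_prime hq).1 h3 with h | h
      · exact absurd (Subgroup.card_eq_one.1 h) hne
      · rw [h, h1]
    have h5 : z ∈ V := inf_eq_right.1 h4 (Subgroup.mem_zpowers z)
    exact hvz (congrArg Subtype.val (mul_comm' (⟨v, hv⟩ : V) ⟨z, h5⟩))
  · rw [← Subgroup.normal_mul, htop, Subgroup.coe_top]

theorem nonempty_mulEquiv_of_conj {E E' : Type*} [Group E] [Group E'] {V : Subgroup E}
    {V' : Subgroup E'} [V.Normal] [V'.Normal] {z : E} {y' : E'}
    (h : V.IsComplement' (Subgroup.zpowers z)) (h' : V'.IsComplement' (Subgroup.zpowers y'))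
    (ho : orderOf z = orderOf y') (φ : V ≃* V')
    (hφ : ∀ v, φ (MulAut.conjNormal z v) = MulAut.conjNormal y' (φ v)) : Nonempty (E ≃* E') := by
  have hg : ∀ x : Subgroup.zpowers z, x ∈ Subgroup.zpowers
      (⟨z, Subgroup.mem_zpowers z⟩ : Subgroup.zpowers z) := by
    rintro ⟨_, n, rfl⟩
    exact ⟨n, rfl⟩
  have hg' : ∀ x : Subgroup.zpowers y', x ∈ Subgroup.zpowers
      (⟨y', Subgroup.mem_zpowers y'⟩ : Subgroup.zpowers y') := by
    rintro ⟨_, n, rfl⟩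
    exact ⟨n, rfl⟩
  let ψ : Subgroup.zpowers z ≃* Subgroup.zpowers y' :=
    mulEquivOfOrderOfEq hg hg' (by rw [Subgroup.orderOf_mk, Subgroup.orderOf_mk, ho])
  have hψ : ψ ⟨z, Subgroup.mem_zpowers z⟩ = ⟨y', Subgroup.mem_zpowers y'⟩ :=
    mulEquivOfOrderOfEq_apply_gen _ _ _
  refine ⟨((SemidirectProduct.mulEquivSubgroup h).symm.trans
    (SemidirectProduct.congr φ ψ ?_)).trans (SemidirectProduct.mulEquivSubgroup h')⟩
  have key := (MonoidHom.eq_iff_eq_on_generator hg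
    ((MulAut.congr φ).toMonoidHom.comp
      (V.normalizerMonoidHom.comp (Subgroup.inclusion (V.normalizer_eq_top ▸ le_top))))
    ((V'.normalizerMonoidHom.comp (Subgroup.inclusion (V'.normalizer_eq_top ▸ le_top))).comp
      ψ.toMonoidHom)).2 ?_
  · intro g
    ext v
    have h1 := DFunLike.congr_fun (DFunLike.congr_fun key g) (φ v)
    simpa using congrArg Subtype.val h1
  · ext w
    have h1 := hφ (φ.symm w)
    rw [MulEquiv.apply_symm_apply] at h1
    change ((φ (V.normalizerMonoidHom _ (φ.symm w)) : V') : E') =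
      ((V'.normalizerMonoidHom (Subgroup.inclusion _ (ψ _)) w : V') : E')
    rw [hψ]
    exact congrArg Subtype.val h1

/-- Replacing `y` by a power `y ^ i` generating the same subgroup makes the two conjugation
operators similar. A similarity extends to the semidirect products. -/
theorem IsPrimitiveExtension.nonempty_mulEquiv {p q : ℕ} (hp : p.Prime) (hq : q.Prime)
    {E E' : Type*} [Group E] [Group E'] [Finite E] [Finite E'] (hE : IsPrimitiveExtension p q E)
    (hE' : IsPrimitiveExtension p q E') : Nonempty (E ≃* E') := by
  obtain ⟨V, y, hV, hVc, hVp, hyq, htop, v, hv, hvy⟩ := hE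
  obtain ⟨V', y', hV', hVc', hVp', hyq', htop', v', hv', hvy'⟩ := hE'
  have := hV.prop.1
  have := hV'.prop.1
  have := Fact.mk hp
  let _ : Module (ZMod p) (Additive V) := AddCommGroup.zmodModule fun a =>
    Additive.toMul.injective (Subtype.ext (hVp _ (Additive.toMul a).2))
  let _ : Module (ZMod p) (Additive V') := AddCommGroup.zmodModule fun a =>
    Additive.toMul.injective (Subtype.ext (hVp' _ (Additive.toMul a).2))
  obtain ⟨i, hi, φ, hφ⟩ := (isIrreducibleOperator_conjLinearMap (p := p) hV htop).exists_linearEquiv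
    hq (isIrreducibleOperator_conjLinearMap (p := p) hV' htop')
    (by ext a; rw [conjLinearMap_pow_apply, hyq, map_one]; rfl)
    (by ext a; rw [conjLinearMap_pow_apply, hyq', map_one]; rfl)
    (fun h => by
      have h1 := congrArg (fun a : Additive V => ((Additive.toMul a : V) : E))
        (LinearMap.congr_fun h (Additive.ofMul ⟨v, hv⟩))
      have h2 : y * v * y⁻¹ = v := h1
      exact hvy (mul_inv_eq_iff_eq_mul.1 h2).symm)
    (fun h => by
      have h1 := congrArg (fun a : Additive V' => ((Additive.toMul a : V') : E'))
        (LinearMap.congr_fun h (Additive.ofMul ⟨v', hv'⟩))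
      have h2 : y' * v' * y'⁻¹ = v' := h1
      exact hvy' (mul_inv_eq_iff_eq_mul.1 h2).symm)
  obtain ⟨j, hj⟩ : ∃ j, (y ^ i) ^ j = y := by
    obtain ⟨j, -, hj⟩ := Nat.exists_mul_mod_eq_one_of_coprime hi hq.one_lt
    exact ⟨j, by rw [← pow_mul, pow_eq_pow_mod _ hyq, hj, pow_one]⟩
  have hz : Subgroup.zpowers y ≤ Subgroup.zpowers (y ^ i) := by
    rw [Subgroup.zpowers_le]
    exact Subgroup.mem_zpowers_iff.2 ⟨j, by rw [zpow_natCast, hj]⟩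
  obtain ⟨hc, ho⟩ := isComplement'_zpowers hq (z := y ^ i)
    (by rw [← pow_mul, mul_comm, pow_mul, hyq, one_pow])
    (eq_top_iff.2 (htop.ge.trans (sup_le_sup_left hz V)))
    ⟨v, hv, fun h => hvy (hj ▸ h.pow_right j)⟩
  obtain ⟨hc', ho'⟩ := isComplement'_zpowers hq hyq' htop' ⟨v', hv', hvy'⟩
  refine nonempty_mulEquiv_of_conj hc hc' (ho.trans ho'.symm)
    (MulEquiv.toAdditive.symm φ.toAddEquiv) fun w => ?_
  have h1 := hφ (Additive.ofMul w)
  rw [conjLinearMap_pow_apply] at h1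
  exact congrArg Additive.toMul h1

end

/-! ### Formations and the Schmidt graph -/

theorem IsSchmidtPQGroup.hasSchmidtSubgroup_self {p q : ℕ} {S : Type*} [Group S]
    (hS : IsSchmidtPQGroup p q S) : HasSchmidtSubgroup p q S :=
  ⟨⊤, hS.of_mulEquiv Subgroup.topEquiv.symm⟩

/-- Both factors map to `G` and these maps separate points, so a Schmidt subgroup of the product has
a Schmidt image in `G`. -/
theorem schmidtGraph_prod_subgroup {G : Type u} [Group G] [Finite G] (H : Subgroup G) :
    schmidtGraph (G × H) = schmidtGraph G := by
  have hs : Function.Surjective (MonoidHom.fst G H) := Prod.fst_surjective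
  refine NatDigraph.ext (Set.Subset.antisymm (fun p hp => ?_) (groupPrimes_subset_of_surjective hs))
    (Set.ext fun e => ⟨fun h => ?_, fun h => HasSchmidtSubgroup.of_quotient _ hs h⟩)
  · obtain ⟨hp, hd⟩ := mem_groupPrimes.1 hp
    rw [Nat.card_prod, hp.dvd_mul] at hd
    exact mem_groupPrimes.2 ⟨hp, hd.elim id fun h => h.trans H.card_subgroup_dvd_card⟩
  · refine (HasSchmidtSubgroup.exists_of_iInf_ker (ι := Bool) (H := fun _ => G)
      (fun b => cond b (MonoidHom.fst G H) (H.subtype.comp (MonoidHom.snd G H))) ?_ h).elim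
      fun _ h => h
    rw [eq_bot_iff]
    intro x hx
    have h1 := Subgroup.mem_iInf.1 hx true
    have h2 := Subgroup.mem_iInf.1 hx false
    exact Prod.ext h1 (Subtype.ext h2)

/-- Under these hypotheses every Schmidt subgroup and every subgroup of prime order is proper, so it
is a subgroup of some factor. -/
theorem schmidtGraph_pi_proper {G : Type u} [Group G] [Finite G] (hS : ¬ IsSchmidtGroup G)
    (hp : ¬ (Nat.card G).Prime) :
    schmidtGraph (∀ H : {H : Subgroup G // H ≠ ⊤}, H.1) = schmidtGraph G := by
  have hs : ∀ H : {H : Subgroup G // H ≠ ⊤}, Function.Surjective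
      (Pi.evalMonoidHom (fun H : {H : Subgroup G // H ≠ ⊤} => H.1) H) :=
    fun H => Function.surjective_eval H
  refine NatDigraph.ext (Set.Subset.antisymm (fun p hpm => ?_) fun p hpm => ?_)
    (Set.ext fun e => ⟨fun h => ?_, ?_⟩)
  · obtain ⟨hp, hd⟩ := mem_groupPrimes.1 hpm
    have := Fintype.ofFinite {H : Subgroup G // H ≠ ⊤}
    rw [Nat.card_pi, hp.prime.dvd_finsetProd_iff] at hd
    obtain ⟨H, -, hH⟩ := hd
    exact mem_groupPrimes.2 ⟨hp, hH.trans H.1.card_subgroup_dvd_card⟩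
  · obtain ⟨hpp, hd⟩ := mem_groupPrimes.1 hpm
    have := Fact.mk hpp
    obtain ⟨x, hx⟩ := exists_prime_orderOf_dvd_card' p hd
    have hne : Subgroup.zpowers x ≠ ⊤ := by
      intro h
      rw [← Subgroup.card_top (G := G), ← h, Nat.card_zpowers, hx] at hp
      exact hp hpp
    refine groupPrimes_subset_of_surjective (hs ⟨_, hne⟩) (mem_groupPrimes.2 ⟨hpp, ?_⟩)
    rw [Nat.card_zpowers, hx]
  · obtain ⟨H, h⟩ := HasSchmidtSubgroup.exists_of_iInf_ker
      (fun H => Pi.evalMonoidHom (fun H : {H : Subgroup G // H ≠ ⊤} => H.1) H) (by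
        rw [eq_bot_iff]
        intro x hx
        exact funext fun H => Subgroup.mem_iInf.1 hx H) h
    exact h.of_injective H.1.subtype H.1.subtype_injective
  · rintro ⟨S, hSS⟩
    have hne : S ≠ ⊤ := by
      rintro rfl
      exact hS (hSS.of_mulEquiv Subgroup.topEquiv).1
    exact hSS.hasSchmidtSubgroup_self.of_quotient _ (hs ⟨S, hne⟩)

theorem frattini_le_frattiniSolubleRadical {G : Type*} [Group G] (h : Group.IsSolvable G) :
    frattini G ≤ frattiniSolubleRadical G := by
  unfold frattiniSolubleRadical
  rw [solubleRadical_eq_top h]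
  intro x hx
  exact ⟨_, frattini_le_comap_frattini_of_surjective
    (φ := (Subgroup.topEquiv (G := G)).symm.toMonoidHom) Subgroup.topEquiv.symm.surjective hx, rfl⟩

namespace FiniteGroupClass

variable {F : FiniteGroupClass.{u}}

theorem IsFormation.mem_pi (hF : F.IsFormation) {ι : Type u} [Finite ι] [Nonempty ι]
    (H : ι → Type u) [∀ i, Group (H i)] (h : ∀ i, F.Mem (H i)) : F.Mem (∀ i, H i) := by
  have := fun i => F.finite_of_mem (H i) (h i)
  obtain ⟨n, ⟨e⟩⟩ := Finite.exists_equiv_fin ι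
  have hn : 1 ≤ n := by
    have := (e (Classical.arbitrary ι)).pos
    omega
  refine hF.2 _ n (fun j => (Pi.evalMonoidHom H (e.symm j)).ker) hn (fun j => ?_) ?_
  · exact F.mem_of_mulEquiv _ _ (QuotientGroup.quotientKerEquivOfSurjective
      (Pi.evalMonoidHom H (e.symm j)) (Function.surjective_eval _)).symm (h _)
  · rw [eq_bot_iff]
    intro x hx
    refine Subgroup.mem_bot.2 (funext fun i => ?_)
    have h1 := Subgroup.mem_iInf.1 hx (e i)
    rw [MonoidHom.mem_ker, Equiv.symm_apply_apply] at h1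
    exact h1

theorem IsRecognizedBy.isSClosed (hF : F.IsFormation) (hr : F.IsRecognizedBy schmidtGraph.{u}) :
    F.IsSClosed := by
  intro G _ H hG
  have := F.finite_of_mem G hG
  exact hF.1 (G × H) H (MonoidHom.snd G H) Prod.snd_surjective
    (hr G (G × H) hG (schmidtGraph_prod_subgroup H).symm)

theorem IsRecognizedBy.isSolublySaturated (hr : F.IsRecognizedBy schmidtGraph.{u}) :
    F.IsSolublySaturated := fun G _ _ h =>
  hr _ G h (schmidtGraph_quotient_frattiniSolubleRadical G)

theorem IsRecognizedBy.hasShemetkovProperty (hF : F.IsFormation) (hne : F.IsNonempty)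
    (hr : F.IsRecognizedBy schmidtGraph.{u}) : F.HasShemetkovProperty := by
  intro G _ _ hG
  by_contra! h
  -- The product needs at least one factor. A trivial `G` has no proper subgroups, but it lies in
  -- `F` as an image of any member.
  have hbot : (⊥ : Subgroup G) ≠ ⊤ := by
    intro hbt
    obtain ⟨G₀, _, hG₀⟩ := hne
    refine hG.1 (hF.1 G₀ G 1 (fun x => ⟨1, ?_⟩) hG₀)
    exact (Subgroup.mem_bot.1 (hbt.ge (Subgroup.mem_top x))).symm
  have : Nonempty {H : Subgroup G // H ≠ ⊤} := ⟨⊥, hbot⟩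
  exact hG.1 (hr _ G (hF.mem_pi (fun H : {H : Subgroup G // H ≠ ⊤} => H.1) fun H => hG.2 H.1 H.2)
    (schmidtGraph_pi_proper h.1 h.2))

/-- All Schmidt `(p, q)`-groups belong to a solubly saturated formation as soon as one does. -/
theorem IsSolublySaturated.mem_of_isSchmidtPQGroup (hF : F.IsFormation) (hs : F.IsSolublySaturated)
    {p q : ℕ} {S T : Type u} [Group S] [Group T] (hS : IsSchmidtPQGroup p q S)
    (hT : IsSchmidtPQGroup p q T) (h : F.Mem S) : F.Mem T := by
  have := hS.finite
  have := hT.finite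
  obtain ⟨N, _, -, hE⟩ := hS.exists_quotient_isPrimitiveExtension
  obtain ⟨M, _, hM, hE'⟩ := hT.exists_quotient_isPrimitiveExtension
  obtain ⟨e⟩ := hE.nonempty_mulEquiv hS.prime_left hS.prime_right hE'
  have h1 : F.Mem (T ⧸ M) := F.mem_of_mulEquiv _ _ e
    (hF.1 _ _ (QuotientGroup.mk' N) (QuotientGroup.mk'_surjective N) h)
  -- `T` is soluble, so it is its own soluble radical and saturation applies to `Φ(T)`.
  have hle := hM.trans (frattini_le_frattiniSolubleRadical hT.isSolvable)
  refine hs T (hF.1 _ _ (QuotientGroup.map M (frattiniSolubleRadical T) (MonoidHom.id T) hle) ?_ h1)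
  rintro ⟨x⟩
  exact ⟨(x : T ⧸ M), rfl⟩

theorem exists_isSCritical {G : Type u} [Group G] [Finite G] (hG : ¬ F.Mem G) :
    ∃ H : Subgroup G, F.IsSCritical H := by
  obtain ⟨H, hH⟩ := Set.Finite.exists_minimal (Set.toFinite {H : Subgroup G | ¬ F.Mem H})
    ⟨⊤, fun h => hG (F.mem_of_mulEquiv _ _ Subgroup.topEquiv h)⟩
  refine ⟨H, hH.prop, fun K hK => ?_⟩
  by_contra hn
  have h1 : ¬ F.Mem (K.map H.subtype) := fun h =>
    hn (F.mem_of_mulEquiv _ _ (K.equivMapOfInjective H.subtype H.subtype_injective).symm h)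
  have h2 : K.map H.subtype = H := le_antisymm (Subgroup.map_subtype_le K)
    (hH.le_of_le h1 (Subgroup.map_subtype_le K))
  refine hK (Subgroup.map_injective H.subtype_injective ?_)
  rw [h2, ← MonoidHom.range_eq_map, Subgroup.range_subtype]

theorem IsHereditaryFormation.isRecognizedBy (hF : F.IsHereditaryFormation)
    (hs : F.IsSolublySaturated) (hsh : F.HasShemetkovProperty) :
    F.IsRecognizedBy schmidtGraph.{u} := by
  intro G₁ G₂ _ _ _ _ hG₁ hΓ
  by_contra hG₂
  obtain ⟨H, hH⟩ := exists_isSCritical hG₂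
  rcases hsh H hH with hS | hp
  · obtain ⟨p, q, hpq⟩ := hS.exists_isSchmidtPQGroup
    have h1 : (p, q) ∈ (schmidtGraph G₂).edges := ⟨H, hpq⟩
    rw [← hΓ] at h1
    obtain ⟨K, hK⟩ := h1
    exact hH.1 (hs.mem_of_isSchmidtPQGroup hF.1 hK hpq (hF.2 G₁ K hG₁))
  · have h1 : Nat.card H ∈ (schmidtGraph G₂).verts :=
      mem_groupPrimes.2 ⟨hp, H.card_subgroup_dvd_card⟩
    rw [← hΓ] at h1
    have := Fact.mk hp
    obtain ⟨x, hx⟩ := exists_prime_orderOf_dvd_card' (Nat.card H) (mem_groupPrimes.1 h1).2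
    refine hH.1 (F.mem_of_mulEquiv (Subgroup.zpowers x) H
      (mulEquivOfPrimeCardEq (p := Nat.card H) ?_ rfl) (hF.2 G₁ _ hG₁))
    rw [Nat.card_zpowers, hx]

end FiniteGroupClass

theorem theorem4p4 (F : FiniteGroupClass.{u}) (hF : F.IsFormation) (hne : F.IsNonempty) :
    F.IsRecognizedBy schmidtGraph.{u} ↔
      F.IsHereditaryFormation ∧ F.IsSolublySaturated ∧ F.HasShemetkovProperty :=
  ⟨fun h => ⟨⟨hF, h.isSClosed hF⟩, h.isSolublySaturated, h.hasShemetkovProperty hF hne⟩,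
    fun h => h.1.isRecognizedBy h.2.1 h.2.2⟩
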